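/- Let $(\xi_n)_{n\in\mathbb Z}$ be a strictly stationary Markov chain, defined on a probability space $(\Omega,\mathcal F,\mathbb P)$, with values in a measurable space $(S,\mathcal A)$ and with marginal distribution $\pi$. Assume that it is totally ergodic: for every integer $m\ge 1$, the $m$-th power $\theta^m$ of the shift $\theta$ on $S^{\mathbb Z}$ is ergodic with respect to the law of $(\xi_n)_{n\in\mathbb Z}$. Let $f:S\to\mathbb R$ be measurable with $\int f^2\,d\pi<\infty$ and $\int f\,d\pi=0$, and put $X_i=f(\xi_i)$, $S_n=\sum_{i=1}^n X_i$ and $\|X\|^2=E(X^2)$. Assume that $$\sup_{n\ge1}\frac{E(S_n^2)}{n}<\infty\qquad\text{and}\qquad \lim_{n\to\infty}\frac1n\,\|E(S_n\mid\xi_0,\xi_n)\|^2=0 .$$ Then the limit $$\sigma^2=\lim_{n\to\infty}\frac1n\,\|S_n-E(S_n\mid\xi_0,\xi_n)\|^2$$ exists and is finite, and $$\lim_{n\to\infty}\frac{E(S_n^2)}{n}=\sigma^2,\qquad \frac{S_n}{\sqrt n}\Rightarrow N(0,\sigma^2),$$ where $\Rightarrow$ denotes convergence in distribution and $N(0,0)$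 is the point mass at $0$. -/

import Mathlib

open MeasureTheory ProbabilityTheory Filter Topology

noncomputable section

namespace MarkovCLT

/-- The left shift `θ` on two-sided sequences: `(θ x) k = x (k + 1)`. -/
def shift {S : Type*} (x : ℤ → S) : ℤ → S := fun k => x (k + 1)

/-- The law, on the two-sided path space `ℤ → S` with the product σ-algebra, of the sequence `ξ`. -/
def pathLaw {Ω S : Type*} [MeasurableSpace Ω] [MeasurableSpace S]
    (μ : Measure Ω) (ξ : ℤ → Ω → S) : Measure (ℤ → S) :=
  μ.map (fun ω k => ξ k ω)

/-- The past σ-algebra `σ(ξ k, k ≤ n)`. -/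
abbrev past {Ω S : Type*} [MeasurableSpace S] (ξ : ℤ → Ω → S) (n : ℤ) : MeasurableSpace Ω :=
  ⨆ k ≤ n, MeasurableSpace.comap (ξ k) inferInstance

/-- `(ξ n)_{n ∈ ℤ}` is a strictly stationary Markov chain with values in the measurable space `S`. -/
structure IsStationaryMarkovChain {Ω S : Type*} [MeasurableSpace Ω] [MeasurableSpace S]
    (μ : Measure Ω) (ξ : ℤ → Ω → S) : Prop where
  /-- every `ξ n` is a random variable -/
  measurable : ∀ n, Measurable (ξ n)
  /-- strict stationarity: the law of the whole sequence is invariant under the shift -/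
  stationary : (pathLaw μ ξ).map shift = pathLaw μ ξ
  /-- Markov property: `ℙ(ξ (n+1) ∈ A | σ(ξ k, k ≤ n)) = ℙ(ξ (n+1) ∈ A | ξ n)` almost surely -/
  markov : ∀ (n : ℤ) (A : Set S), MeasurableSet A →
    μ⟦ξ (n + 1) ⁻¹' A | past ξ n⟧ =ᵐ[μ]
      μ⟦ξ (n + 1) ⁻¹' A | MeasurableSpace.comap (ξ n) inferInstance⟧

/-- Total ergodicity: every power `θ^m`, `m ≥ 1`, of the shift is ergodic for the law of `ξ`. -/
def IsTotallyErgodic {Ω S : Type*} [MeasurableSpace Ω] [MeasurableSpace S]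
    (μ : Measure Ω) (ξ : ℤ → Ω → S) : Prop :=
  ∀ m : ℕ, 1 ≤ m → Ergodic (shift^[m]) (pathLaw μ ξ)

/-- The partial sum `S_n = f(ξ 1) + ⋯ + f(ξ n)`. -/
def partialSum {Ω S : Type*} (ξ : ℤ → Ω → S) (f : S → ℝ) (n : ℕ) : Ω → ℝ :=
  fun ω => ∑ i ∈ Finset.Icc 1 n, f (ξ (i : ℤ) ω)

/-- The conditional expectation `E(S_n | ξ 0, ξ n)`. -/
def condEndpoints {Ω S : Type*} [MeasurableSpace Ω] [MeasurableSpace S]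
    (μ : Measure Ω) (ξ : ℤ → Ω → S) (f : S → ℝ) (n : ℕ) : Ω → ℝ :=
  μ[partialSum ξ f n | MeasurableSpace.comap (ξ 0) inferInstance ⊔
    MeasurableSpace.comap (ξ (n : ℤ)) inferInstance]

/-- The squared norm `‖X‖² = E(X²)` of `𝕃²(Ω, ℱ, ℙ)`. -/
def normSq {Ω : Type*} [MeasurableSpace Ω] (μ : Measure Ω) (X : Ω → ℝ) : ℝ :=
  ∫ ω, X ω ^ 2 ∂μ

end MarkovCLT

end

/-! Write Y for the deviation of a block sum from its conditional mean given the two endpoints of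
the block (`blockDev`). By the Markov property, Y is centered not only given the endpoints but given
the whole past of the left one together with any finite stretch of the future of the right one
(`condExp_past_sup_window`). Everything rests on this orthogonality.

Variance. When a block is cut in two, the deviations of the pieces are orthogonal to each other and
to what remains of the deviation of the whole, so the squared norm of Y is superadditive in the
block length. The bound on E(S_n²)/n and Fekete's lemma then give the limit σ²
(`exists_tendsto_normSq_blockDev_div`). Since E(S_n²) is the squared norm of the conditional mean
plus that of Y, and the former is o(n), E(S_n²)/n has the same limit.

Martingale approximation. For fixed m, the deviations of consecutive blocks of length m are
stationary martingale differences. The sum S_{um} minus the first u of them has squared norm exactly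
E(S_{um}²) - u‖Y_m‖² (`normSq_block_sub_sum_blockDev_eq`). Divided by um this tends to σ² -
‖Y_m‖²/m, which is small for large m.

Martingale CLT. Total ergodicity makes θ^m ergodic, so by the mean ergodic theorem the sum of
squares over a group of L deviations is close in L¹ to its mean, for a suitable L. A second order
expansion shows that each group multiplies the characteristic function by a Gaussian factor, up to a
small error, and the errors add (`norm_integral_exp_sum_sub_le`). Letting n → ∞ and then m → ∞ gives
the limit law. -/

noncomputable section

namespace MarkovCLT

/-! ### Conditional expectations: orthogonality, π-system arguments, transport -/

section CondExp

variable {Ω : Type*} {mΩ : MeasurableSpace Ω} {μ : Measure Ω}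

/-- If `W` is centered given `m`, it is orthogonal to every `m`-measurable `Z`. -/
lemma integral_smul_eq_zero_of_condExp_eq_zero [IsProbabilityMeasure μ]
    {E : Type*} [NormedAddCommGroup E] [NormedSpace ℝ E] [CompleteSpace E] {m : MeasurableSpace Ω} (hm : m ≤ mΩ) {W : Ω → ℝ}
    {Z : Ω → E} (hW : Integrable W μ) (hZ : StronglyMeasurable[m] Z)
    (hWZ : Integrable (W • Z) μ) (h0 : μ[W | m] =ᵐ[μ] 0) : ∫ ω, W ω • Z ω ∂μ = 0 := by
  have h1 := condExp_smul_of_aestronglyMeasurable_right hW hWZ hZ.aestronglyMeasurable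
  have h2 : μ[W • Z | m] =ᵐ[μ] 0 := by
    filter_upwards [h1, h0] with ω h1 h0
    rw [h1, Pi.smul_apply', h0]
    simp
  have h3 := integral_condExp (μ := μ) (f := W • Z) hm
  rw [integral_congr_ae h2] at h3
  simpa using h3.symm

lemma condExp_eq_zero_of_setIntegral_eq_zero [IsProbabilityMeasure μ] {m : MeasurableSpace Ω} (hm : m ≤ mΩ) {W : Ω → ℝ}
    (hW : Integrable W μ) (h0 : ∀ A, MeasurableSet[m] A → ∫ ω in A, W ω ∂μ = 0) :
    μ[W | m] =ᵐ[μ] 0 := by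
  refine (ae_eq_condExp_of_forall_setIntegral_eq hm hW (fun _ _ _ => ?_) (fun A hA _ => ?_) ?_).symm
  · exact (integrable_zero Ω ℝ μ).integrableOn
  · simp [h0 A hA]
  · exact stronglyMeasurable_zero.aestronglyMeasurable

lemma setIntegral_eq_zero_of_isPiSystem {m : MeasurableSpace Ω} (hm : m ≤ mΩ) {W : Ω → ℝ}
    (hW : Integrable W μ) {C : Set (Set Ω)} (hC : m = MeasurableSpace.generateFrom C)
    (hpi : IsPiSystem C) (huniv : ∫ ω, W ω ∂μ = 0) (h0 : ∀ A ∈ C, ∫ ω in A, W ω ∂μ = 0)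
    {A : Set Ω} (hA : MeasurableSet[m] A) : ∫ ω in A, W ω ∂μ = 0 := by
  induction A, hA using MeasurableSpace.induction_on_inter hC hpi with
  | empty => simp
  | basic A hA => exact h0 A hA
  | compl A hA ih =>
    have := integral_add_compl (hm A hA) hW
    rw [ih, huniv] at this
    simpa using this
  | iUnion g hd hg ih =>
    rw [integral_iUnion (fun i => hm _ (hg i)) hd hW.integrableOn]
    simp [ih]

lemma setIntegral_eq_zero_of_sup {p r : MeasurableSpace Ω} (hp : p ≤ mΩ) (hr : r ≤ mΩ)
    {W : Ω → ℝ} (hW : Integrable W μ)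
    (h0 : ∀ A B, MeasurableSet[p] A → MeasurableSet[r] B → ∫ ω in A ∩ B, W ω ∂μ = 0)
    {C : Set Ω} (hC : MeasurableSet[p ⊔ r] C) : ∫ ω in C, W ω ∂μ = 0 := by
  refine setIntegral_eq_zero_of_isPiSystem (sup_le hp hr) hW
    (C := Set.image2 (· ∩ ·) {A | MeasurableSet[p] A} {B | MeasurableSet[r] B}) ?_ ?_ ?_ ?_ hC
  · refine le_antisymm (sup_le (fun A hA => ?_) fun B hB => ?_)
      (MeasurableSpace.generateFrom_le ?_)
    · exact MeasurableSpace.measurableSet_generateFrom ⟨A, hA, Set.univ, .univ, by simp⟩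
    · exact MeasurableSpace.measurableSet_generateFrom ⟨Set.univ, .univ, B, hB, by simp⟩
    · rintro _ ⟨A, hA, B, hB, rfl⟩
      exact MeasurableSet.inter (le_sup_left (a := p) (b := r) A hA)
        (le_sup_right (a := p) (b := r) B hB)
  · rintro _ ⟨A, hA, B, hB, rfl⟩ _ ⟨A', hA', B', hB', rfl⟩ _
    exact ⟨A ∩ A', MeasurableSet.inter hA hA', B ∩ B', MeasurableSet.inter hB hB',
      Set.inter_inter_inter_comm _ _ _ _⟩
  · simpa using h0 Set.univ Set.univ .univ .univ
  · rintro _ ⟨A, hA, B, hB, rfl⟩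
    exact h0 A B hA hB

variable [IsProbabilityMeasure μ]

/-- Self-adjointness of conditional expectation. Boundedness of `G` makes both products integrable
when `F` is only integrable; pulling out the measurable factor then turns each side into the
integral of `μ[F | m] * μ[G | m]`. -/
lemma integral_condExp_mul_comm {m : MeasurableSpace Ω} (hm : m ≤ mΩ) {F G : Ω → ℝ} {c : ℝ}
    (hF : Integrable F μ) (hG : Integrable G μ) (hGc : ∀ᵐ ω ∂μ, |G ω| ≤ c) :
    ∫ ω, (μ[F | m]) ω * G ω ∂μ = ∫ ω, F ω * (μ[G | m]) ω ∂μ := by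
  have hGc' : ∀ᵐ ω ∂μ, |(μ[G | m]) ω| ≤ c :=
    ae_bdd_abs_condExp_of_ae_bdd_abs hGc
  have i1 : Integrable (μ[F | m] * G) μ :=
    integrable_condExp.mul_bdd (c := c) hG.1 (by simpa using hGc)
  have i2 : Integrable (F * μ[G | m]) μ :=
    hF.mul_bdd (c := c) integrable_condExp.1 (by simpa using hGc')
  have e1 := condExp_mul_of_stronglyMeasurable_left (stronglyMeasurable_condExp (m := m)) i1 hG
  have e2 := condExp_mul_of_stronglyMeasurable_right (stronglyMeasurable_condExp (m := m)) i2 hF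
  have h1 := integral_condExp (μ := μ) (f := μ[F | m] * G) hm
  have h2 := integral_condExp (μ := μ) (f := F * μ[G | m]) hm
  rw [integral_congr_ae e1] at h1
  rw [integral_congr_ae e2] at h2
  exact h1.symm.trans h2

lemma integrable_indicator_one {A : Set Ω} (hA : MeasurableSet A) :
    Integrable (A.indicator fun _ : Ω => (1 : ℝ)) μ :=
  (integrable_const _).indicator hA

omit mΩ in
lemma abs_indicator_one_le (A : Set Ω) (ω : Ω) : |A.indicator (fun _ : Ω => (1 : ℝ)) ω| ≤ 1 := by
  by_cases h : ω ∈ A <;> simp [h]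

omit [IsProbabilityMeasure μ] in
lemma setIntegral_eq_integral_mul_indicator {A : Set Ω} (hA : MeasurableSet A) (G : Ω → ℝ) :
    ∫ ω in A, G ω ∂μ = ∫ ω, G ω * A.indicator (fun _ : Ω => (1 : ℝ)) ω ∂μ := by
  rw [← integral_indicator hA]
  refine integral_congr_ae (.of_forall fun ω => ?_)
  by_cases h : ω ∈ A <;> simp [h]

/-- Self-adjointness lets the event and the test set trade places. The discrepancy between 1_C and
its conditional probability, tested on a fixed `A`, becomes the integral over `C` of a fixed
function, so a π-system argument in `C` applies. -/
lemma setIntegral_sub_condExp_indicator_comm {q : MeasurableSpace Ω} (hq : q ≤ mΩ) {A C : Set Ω}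
    (hA : MeasurableSet[mΩ] A) (hC : MeasurableSet[mΩ] C) :
    ∫ ω in C, (A.indicator (fun _ : Ω => (1 : ℝ)) - μ⟦A | q⟧) ω ∂μ =
      ∫ ω in A, (C.indicator (fun _ : Ω => (1 : ℝ)) - μ⟦C | q⟧) ω ∂μ := by
  have hA1 := integrable_indicator_one (μ := μ) hA
  have hC1 := integrable_indicator_one (μ := μ) hC
  simp only [Pi.sub_apply]
  rw [integral_sub hA1.integrableOn integrable_condExp.integrableOn,
    integral_sub hC1.integrableOn integrable_condExp.integrableOn,
    setIntegral_eq_integral_mul_indicator hA, setIntegral_eq_integral_mul_indicator hC,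
    setIntegral_eq_integral_mul_indicator hA, setIntegral_eq_integral_mul_indicator hC,
    integral_condExp_mul_comm hq hA1 hC1 (.of_forall (abs_indicator_one_le C))]
  simp_rw [mul_comm (A.indicator _ _)]

/-- To check that events of `r₁ ⊔ r₂` have the same conditional probability given `p` and given
`q ≤ p`, it is enough to consider intersections. -/
lemma condExp_indicator_eq_of_sup {p q r₁ r₂ : MeasurableSpace Ω} (hqp : q ≤ p) (hp : p ≤ mΩ)
    (hr₁ : r₁ ≤ mΩ) (hr₂ : r₂ ≤ mΩ)
    (H : ∀ B C, MeasurableSet[r₁] B → MeasurableSet[r₂] C → μ⟦B ∩ C | p⟧ =ᵐ[μ] μ⟦B ∩ C | q⟧)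
    {D : Set Ω} (hD : MeasurableSet[r₁ ⊔ r₂] D) : μ⟦D | p⟧ =ᵐ[μ] μ⟦D | q⟧ := by
  have hq := hqp.trans hp
  have hD' : MeasurableSet[mΩ] D := sup_le hr₁ hr₂ D hD
  have hD1 := integrable_indicator_one (μ := μ) hD'
  refine (ae_eq_condExp_of_forall_setIntegral_eq hp hD1 (fun _ _ _ => ?_) (fun A hA _ => ?_)
    (stronglyMeasurable_condExp.mono hqp).aestronglyMeasurable).symm
  · exact integrable_condExp.integrableOn
  have hA' : MeasurableSet[mΩ] A := hp A hA
  have hA1 := integrable_indicator_one (μ := μ) hA'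
  have h0 := setIntegral_eq_zero_of_sup hr₁ hr₂
    (hA1.sub (integrable_condExp (f := A.indicator fun _ => (1 : ℝ)) (m := q)))
    (fun B C hB hC => ?_) hD
  · rw [setIntegral_sub_condExp_indicator_comm hq hA' hD'] at h0
    simp only [Pi.sub_apply] at h0
    rw [integral_sub hD1.integrableOn integrable_condExp.integrableOn, sub_eq_zero] at h0
    exact h0.symm
  · have hBC : MeasurableSet[mΩ] (B ∩ C) := MeasurableSet.inter (hr₁ B hB) (hr₂ C hC)
    have hBC1 := integrable_indicator_one (μ := μ) hBC
    rw [setIntegral_sub_condExp_indicator_comm hq hA' hBC]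
    simp only [Pi.sub_apply]
    rw [integral_sub hBC1.integrableOn integrable_condExp.integrableOn,
      ← setIntegral_condExp hp hBC1 hA, sub_eq_zero]
    refine integral_congr_ae (ae_restrict_of_ae ?_)
    exact H B C hB hC

/-- If events of `r` have the same conditional probability given `p` and given `q ≤ p`, the same
holds for the conditional expectation of any integrable `r`-measurable function. -/
lemma condExp_eq_of_indicator {p q r : MeasurableSpace Ω} (hqp : q ≤ p) (hp : p ≤ mΩ) (hr : r ≤ mΩ)
    (H : ∀ C, MeasurableSet[r] C → μ⟦C | p⟧ =ᵐ[μ] μ⟦C | q⟧) {F : Ω → ℝ} (hF : Integrable F μ)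
    (hFm : StronglyMeasurable[r] F) : μ[F | p] =ᵐ[μ] μ[F | q] := by
  have hq := hqp.trans hp
  refine (ae_eq_condExp_of_forall_setIntegral_eq hp hF (fun _ _ _ => ?_) (fun A hA _ => ?_)
    (stronglyMeasurable_condExp.mono hqp).aestronglyMeasurable).symm
  · exact integrable_condExp.integrableOn
  have hA' : MeasurableSet[mΩ] A := hp A hA
  have hA1 := integrable_indicator_one (μ := μ) hA'
  have hcA : ∀ᵐ ω ∂μ, |(μ⟦A | q⟧) ω| ≤ 1 :=
    ae_bdd_abs_condExp_of_ae_bdd_abs (.of_forall (abs_indicator_one_le A))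
  rw [setIntegral_eq_integral_mul_indicator hA', setIntegral_eq_integral_mul_indicator hA',
    integral_condExp_mul_comm hq hF hA1 (.of_forall (abs_indicator_one_le A))]
  set W : Ω → ℝ := A.indicator (fun _ => (1 : ℝ)) - μ⟦A | q⟧ with hWdef
  have hW : Integrable W μ := hA1.sub integrable_condExp
  have hWb : ∀ᵐ ω ∂μ, ‖W ω‖ ≤ 2 := by
    filter_upwards [hcA] with ω hω
    have := abs_indicator_one_le A ω
    rw [hWdef, Pi.sub_apply, Real.norm_eq_abs]
    exact (abs_sub _ _).trans (by linarith)
  have h0 : μ[W | r] =ᵐ[μ] 0 := by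
    refine condExp_eq_zero_of_setIntegral_eq_zero hr hW fun C hC => ?_
    have hC' : MeasurableSet[mΩ] C := hr C hC
    have hC1 := integrable_indicator_one (μ := μ) hC'
    rw [setIntegral_sub_condExp_indicator_comm hq hA' hC']
    simp only [Pi.sub_apply]
    rw [integral_sub hC1.integrableOn integrable_condExp.integrableOn,
      ← setIntegral_condExp hp hC1 hA, sub_eq_zero]
    exact integral_congr_ae (ae_restrict_of_ae (H C hC))
  -- The bounded function `W` is centered given `r`, hence orthogonal to the `r`-measurable `F`;
  -- this is the required identity on `A`.
  have := integral_smul_eq_zero_of_condExp_eq_zero hr hW hFm (hF.bdd_mul (c := 2) hW.1 hWb) h0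
  simp only [hWdef, Pi.sub_apply, smul_eq_mul, sub_mul] at this
  rw [integral_sub, sub_eq_zero] at this
  · simp_rw [mul_comm (F _)]
    exact this.symm
  · exact hF.bdd_mul (c := 1) hA1.1 (.of_forall (abs_indicator_one_le A))
  · exact hF.bdd_mul (c := 1) integrable_condExp.1 hcA

/-- Conditional expectations commute with measure preserving maps. -/
lemma condExp_comp_measurePreserving {X : Type*} {m mX : MeasurableSpace X} {P : Measure X}
    [IsProbabilityMeasure P] {T : Ω → X} (hT : MeasurePreserving T μ P)
    (hm : m ≤ mX) {F : X → ℝ} (hF : Integrable F P) :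
    (P[F | m]) ∘ T =ᵐ[μ] μ[F ∘ T | m.comap T] := by
  have hm' : m.comap T ≤ mΩ := (MeasurableSpace.comap_mono hm).trans hT.measurable.comap_le
  refine ae_eq_condExp_of_forall_setIntegral_eq hm' (hT.integrable_comp_of_integrable hF)
    (fun _ _ _ => (hT.integrable_comp_of_integrable integrable_condExp).integrableOn) ?_ ?_
  · rintro _ ⟨B, hB, rfl⟩ -
    have key : ∀ G : X → ℝ, AEStronglyMeasurable G P →
        ∫ ω in T ⁻¹' B, (G ∘ T) ω ∂μ = ∫ x in B, G x ∂P := fun G hG => by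
      rw [← hT.map_eq] at hG ⊢
      rw [setIntegral_map (hm B hB) hG hT.measurable.aemeasurable]
      rfl
    rw [key _ integrable_condExp.1, key _ hF.1, setIntegral_condExp hm hF hB]
  · exact (stronglyMeasurable_condExp.comp_measurable
      (comap_measurable T)).aestronglyMeasurable

end CondExp

/-! ### The Markov property for stretches of the future and for two-sided conditioning -/

section Markov

variable {Ω S : Type*} [mΩ : MeasurableSpace Ω] [MeasurableSpace S] {μ : Measure Ω}
  [IsProbabilityMeasure μ] {ξ : ℤ → Ω → S}

/-- The σ-algebra `σ(ξ n)`. -/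
abbrev present (ξ : ℤ → Ω → S) (n : ℤ) : MeasurableSpace Ω :=
  MeasurableSpace.comap (ξ n) inferInstance

/-- The σ-algebra `σ(ξ k, a ≤ k ≤ b)`. -/
abbrev window (ξ : ℤ → Ω → S) (a b : ℤ) : MeasurableSpace Ω :=
  ⨆ k ∈ Set.Icc a b, present ξ k

omit mΩ in
lemma present_le_past {k n : ℤ} (h : k ≤ n) : present ξ k ≤ past ξ n :=
  le_iSup₂_of_le k h le_rfl

omit mΩ in
lemma past_mono {a b : ℤ} (h : a ≤ b) : past ξ a ≤ past ξ b :=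
  iSup₂_le fun _ hk => present_le_past (hk.trans h)

omit mΩ in
lemma present_le_window {a b k : ℤ} (h1 : a ≤ k) (h2 : k ≤ b) : present ξ k ≤ window ξ a b :=
  le_iSup₂_of_le k ⟨h1, h2⟩ le_rfl

omit mΩ in
lemma window_le_past (a b : ℤ) : window ξ a b ≤ past ξ b :=
  iSup₂_le fun _ hk => present_le_past hk.2

omit mΩ in
lemma window_le_sup (a b : ℤ) : window ξ a b ≤ present ξ a ⊔ window ξ (a + 1) b := by
  refine iSup₂_le fun k hk => ?_
  rcases hk.1.eq_or_lt with rfl | h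
  · exact le_sup_left
  · exact (present_le_window h hk.2).trans le_sup_right

namespace IsStationaryMarkovChain

variable (hξ : IsStationaryMarkovChain μ ξ)
include hξ

omit [IsProbabilityMeasure μ] in
lemma present_le (n : ℤ) : present ξ n ≤ mΩ := (hξ.measurable n).comap_le

omit [IsProbabilityMeasure μ] in
lemma past_le (n : ℤ) : past ξ n ≤ mΩ := iSup₂_le fun k _ => hξ.present_le k

omit [IsProbabilityMeasure μ] in
lemma window_le (a b : ℤ) : window ξ a b ≤ mΩ := (window_le_past a b).trans (hξ.past_le b)

/-- Induction on the length of the window. For an event after time `a`, the induction hypothesis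
makes its conditional probability at time `a + 1` a function of ξ_{a+1}; the one-step Markov
property applies to that function and the tower property concludes. A factor depending on ξ_a is
pulled out. -/
lemma condExp_indicator_past (p : ℕ) : ∀ (a : ℤ) (C : Set Ω),
    MeasurableSet[window ξ a (a + p)] C → μ⟦C | past ξ a⟧ =ᵐ[μ] μ⟦C | present ξ a⟧ := by
  induction p with
  | zero =>
    intro a C hC
    have hC' : MeasurableSet[present ξ a] C := by
      refine (iSup₂_le fun k hk => ?_ : window ξ a (a + (0 : ℕ)) ≤ present ξ a) C hC
      obtain rfl : k = a := by have := hk.1; have := hk.2; push_cast at *; omega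
      exact le_rfl
    have hm : StronglyMeasurable[present ξ a] (C.indicator fun _ : Ω => (1 : ℝ)) :=
      stronglyMeasurable_const.indicator hC'
    have hi := integrable_indicator_one (μ := μ) (hξ.present_le a C hC')
    rw [condExp_of_stronglyMeasurable (hξ.present_le a) hm hi,
      condExp_of_stronglyMeasurable (hξ.past_le a) (hm.mono (present_le_past le_rfl)) hi]
  | succ p ih =>
    intro a C hC
    have hle : present ξ a ≤ past ξ a := present_le_past le_rfl
    have hCs := window_le_sup _ _ C hC
    refine condExp_indicator_eq_of_sup hle (hξ.past_le a) (hξ.present_le a) (hξ.window_le _ _)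
      (fun B D hB hD => ?_) hCs
    have hD' : MeasurableSet[mΩ] D := hξ.window_le _ _ D hD
    have hD1 := integrable_indicator_one (μ := μ) hD'
    have hψ : μ⟦D | past ξ (a + 1)⟧ =ᵐ[μ] μ⟦D | present ξ (a + 1)⟧ := by
      refine ih (a + 1) D ?_
      convert! hD using 2
      push_cast; ring
    have hstep : μ⟦D | past ξ a⟧ =ᵐ[μ] μ⟦D | present ξ a⟧ := by
      have hpp : past ξ a ≤ past ξ (a + 1) := past_mono (by omega)
      have h1 : μ[μ⟦D | present ξ (a + 1)⟧ | past ξ a] =ᵐ[μ] μ⟦D | past ξ a⟧ :=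
        (condExp_congr_ae hψ.symm).trans (condExp_condExp_of_le hpp (hξ.past_le _))
      have h2 : μ[μ⟦D | present ξ (a + 1)⟧ | present ξ a] =ᵐ[μ] μ⟦D | present ξ a⟧ :=
        (condExp_congr_ae hψ.symm).trans (condExp_condExp_of_le (hle.trans hpp) (hξ.past_le _))
      refine h1.symm.trans (EventuallyEq.trans ?_ h2)
      refine condExp_eq_of_indicator hle (hξ.past_le a) (hξ.present_le (a + 1)) ?_
        integrable_condExp stronglyMeasurable_condExp
      rintro _ ⟨A, hA, rfl⟩
      exact hξ.markov a A hA
    have hind : (B ∩ D).indicator (fun _ : Ω => (1 : ℝ)) =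
        B.indicator (D.indicator fun _ => 1) := by
      rw [Set.indicator_indicator]
    rw [hind]
    refine (condExp_indicator hD1 (hle B hB)).trans
      (EventuallyEq.trans ?_ (condExp_indicator hD1 hB).symm)
    filter_upwards [hstep] with ω hω
    by_cases h : ω ∈ B <;> simp [h, hω]

/-- The Markov property for functions of a finite stretch of the future. -/
lemma condExp_past {a b : ℤ} (hab : a ≤ b) {F : Ω → ℝ} (hF : Integrable F μ)
    (hFm : StronglyMeasurable[window ξ a b] F) : μ[F | past ξ a] =ᵐ[μ] μ[F | present ξ a] := by
  obtain ⟨p, rfl⟩ := Int.le.dest hab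
  exact condExp_eq_of_indicator (present_le_past le_rfl) (hξ.past_le a) (hξ.window_le _ _)
    (hξ.condExp_indicator_past p a) hF hFm

/-- A function of a stretch of the chain that is centered given the two endpoints is centered given
the past of the first one together with the future of the second one. -/
lemma condExp_past_sup_window {a b c : ℤ} (hab : a ≤ b) (hbc : b ≤ c) {Y : Ω → ℝ}
    (hY : Integrable Y μ) (hYm : StronglyMeasurable[window ξ a b] Y)
    (h0 : μ[Y | present ξ a ⊔ present ξ b] =ᵐ[μ] 0) :
    μ[Y | past ξ a ⊔ window ξ b c] =ᵐ[μ] 0 := by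
  refine condExp_eq_zero_of_setIntegral_eq_zero (sup_le (hξ.past_le a) (hξ.window_le b c)) hY
    fun D hD => setIntegral_eq_zero_of_sup (hξ.past_le a) (hξ.window_le b c) hY
      (fun A C hA hC => ?_) hD
  have hA' : MeasurableSet[mΩ] A := hξ.past_le a A hA
  have hC' : MeasurableSet[mΩ] C := hξ.window_le b c C hC
  have hC1 := integrable_indicator_one (μ := μ) hC'
  have hYA : Integrable (A.indicator Y) μ := hY.indicator hA'
  -- Conditioning on the past of `b` replaces 1_C by `ψ`, a function of ξ_b. Then `Y * ψ` is still
  -- centered given both endpoints, and by the Markov property at `a` it is centered given the past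
  -- of `a`, which contains `A`.
  set ψ : Ω → ℝ := μ⟦C | present ξ b⟧
  have hψm : StronglyMeasurable[present ξ b] ψ := stronglyMeasurable_condExp
  have hψ1 : ∀ᵐ ω ∂μ, ‖ψ ω‖ ≤ 1 :=
    ae_bdd_abs_condExp_of_ae_bdd_abs (.of_forall (abs_indicator_one_le C))
  have e1 : ∫ ω in A ∩ C, Y ω ∂μ = ∫ ω in C, A.indicator Y ω ∂μ := by
    rw [setIntegral_indicator hA', Set.inter_comm]
  have hYAm : StronglyMeasurable[past ξ b] (A.indicator Y) :=
    (hYm.mono (window_le_past a b)).indicator (past_mono hab A hA)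
  have e2 : ∫ ω in C, A.indicator Y ω ∂μ = ∫ ω, A.indicator Y ω * ψ ω ∂μ := by
    rw [setIntegral_eq_integral_mul_indicator hC']
    have h1 := integral_condExp_mul_comm (hξ.past_le b) hYA hC1
      (.of_forall (abs_indicator_one_le C))
    rw [condExp_of_stronglyMeasurable (hξ.past_le b) hYAm hYA] at h1
    rw [h1]
    refine integral_congr_ae ?_
    filter_upwards [hξ.condExp_past hbc hC1 (stronglyMeasurable_const.indicator hC)] with ω hω
    rw [hω]
  have hYψ : Integrable (Y * ψ) μ := hY.mul_bdd (c := 1) integrable_condExp.1 hψ1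
  have e3 : ∫ ω, A.indicator Y ω * ψ ω ∂μ = ∫ ω in A, (Y * ψ) ω ∂μ := by
    rw [← integral_indicator hA']
    refine integral_congr_ae (.of_forall fun ω => ?_)
    by_cases h : ω ∈ A <;> simp [h]
  have h4 : μ[Y * ψ | present ξ a ⊔ present ξ b] =ᵐ[μ] 0 := by
    have hψm' : StronglyMeasurable[present ξ a ⊔ present ξ b] ψ :=
      hψm.mono (le_sup_right (a := present ξ a))
    refine (condExp_mul_of_stronglyMeasurable_right hψm' hYψ hY).trans ?_
    filter_upwards [h0] with ω hω
    simp [hω]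
  have h5 : μ[Y * ψ | past ξ a] =ᵐ[μ] 0 := by
    refine (hξ.condExp_past hab hYψ (hYm.mul (hψm.mono (present_le_window hab le_rfl)))).trans ?_
    refine (condExp_condExp_of_le (le_sup_left (b := present ξ b))
      (sup_le (hξ.present_le a) (hξ.present_le b))).symm.trans ?_
    refine (condExp_congr_ae h4).trans ?_
    rw [condExp_zero]
  rw [e1, e2, e3, ← setIntegral_condExp (hξ.past_le a) hYψ hA]
  rw [integral_congr_ae (ae_restrict_of_ae h5)]
  simp

end IsStationaryMarkovChain

end Markov

/-! ### Block sums, their deviations, orthogonality and stationarity -/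

section Blocks

variable {Ω S : Type*} [mΩ : MeasurableSpace Ω] [MeasurableSpace S] {μ : Measure Ω}
  {ξ : ℤ → Ω → S} {f : S → ℝ}

/-- The block sum `∑_{a < i ≤ b} f (ξ i)`. -/
def block (ξ : ℤ → Ω → S) (f : S → ℝ) (a b : ℤ) : Ω → ℝ :=
  fun ω => ∑ i ∈ Finset.Ioc a b, f (ξ i ω)

/-- The conditional expectation of a block sum given the two endpoints of the block. -/
def blockMean (μ : Measure Ω) (ξ : ℤ → Ω → S) (f : S → ℝ) (a b : ℤ) : Ω → ℝ :=
  μ[block ξ f a b | present ξ a ⊔ present ξ b]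

/-- The deviation of a block sum from its conditional expectation given the endpoints. -/
def blockDev (μ : Measure Ω) (ξ : ℤ → Ω → S) (f : S → ℝ) (a b : ℤ) : Ω → ℝ :=
  block ξ f a b - blockMean μ ξ f a b

omit mΩ [MeasurableSpace S] in
lemma partialSum_eq_block (n : ℕ) : partialSum ξ f n = block ξ f 0 n := by
  funext ω
  refine Finset.sum_nbij' (fun i : ℕ => (i : ℤ)) Int.toNat ?_ ?_ ?_ ?_ ?_
  all_goals intro i hi
  all_goals simp only [Finset.mem_Icc, Finset.mem_Ioc] at *
  all_goals omega

lemma condEndpoints_eq_blockMean (n : ℕ) : condEndpoints μ ξ f n = blockMean μ ξ f 0 n := by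
  rw [condEndpoints, partialSum_eq_block, blockMean]

lemma blockMean_add_blockDev (a b : ℤ) :
    blockMean μ ξ f a b + blockDev μ ξ f a b = block ξ f a b := by
  simp [blockDev]

omit mΩ [MeasurableSpace S] in
lemma block_add_block {a b c : ℤ} (hab : a ≤ b) (hbc : b ≤ c) :
    block ξ f a b + block ξ f b c = block ξ f a c := by
  funext ω
  rw [Pi.add_apply, block, block, block, ← Finset.Ioc_union_Ioc_eq_Ioc hab hbc,
    Finset.sum_union (Finset.Ioc_disjoint_Ioc_of_le le_rfl)]

omit mΩ in
lemma stronglyMeasurable_block (hf : Measurable f) {a b : ℤ} :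
    StronglyMeasurable[window ξ a b] (block ξ f a b) := by
  have : ∀ i ∈ Finset.Ioc a b, Measurable[window ξ a b] fun ω => f (ξ i ω) := fun i hi => by
    rw [Finset.mem_Ioc] at hi
    refine Measurable.mono (hf.comp (comap_measurable (ξ i))) ?_ le_rfl
    exact present_le_window hi.1.le hi.2
  exact (Finset.measurable_fun_sum _ this).stronglyMeasurable

lemma stronglyMeasurable_blockMean {a b : ℤ} :
    StronglyMeasurable[present ξ a ⊔ present ξ b] (blockMean μ ξ f a b) :=
  stronglyMeasurable_condExp

omit mΩ in
lemma present_sup_present_le_window {a b : ℤ} (hab : a ≤ b) :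
    present ξ a ⊔ present ξ b ≤ window ξ a b :=
  sup_le (present_le_window le_rfl hab) (present_le_window hab le_rfl)

lemma stronglyMeasurable_blockDev (hf : Measurable f) {a b : ℤ} (hab : a ≤ b) :
    StronglyMeasurable[window ξ a b] (blockDev μ ξ f a b) :=
  (stronglyMeasurable_block hf).sub
    (stronglyMeasurable_blockMean.mono (present_sup_present_le_window hab))

/-- The path `k ↦ ξ k ω`. -/
def path (ξ : ℤ → Ω → S) (ω : Ω) : ℤ → S := fun k => ξ k ω

omit mΩ [MeasurableSpace S] in
lemma shift_iterate_apply (n : ℕ) (x : ℤ → S) (k : ℤ) : shift^[n] x k = x (k + n) := by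
  induction n generalizing x with
  | zero => simp
  | succ n ih =>
    rw [Function.iterate_succ_apply, ih, shift]
    congr 1
    push_cast; ring

lemma normSq_eq_of_ae {X Y : Ω → ℝ} (h : X =ᵐ[μ] Y) : normSq μ X = normSq μ Y :=
  integral_congr_ae (h.mono fun ω hω => by simp only [hω])

lemma normSq_nonneg (X : Ω → ℝ) : 0 ≤ normSq μ X :=
  integral_nonneg fun _ => sq_nonneg _

namespace IsStationaryMarkovChain

section

variable (hξ : IsStationaryMarkovChain μ ξ)
include hξ

lemma measurePreserving_path : MeasurePreserving (path ξ) μ (pathLaw μ ξ) :=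
  ⟨measurable_pi_lambda _ hξ.measurable, rfl⟩

lemma isProbabilityMeasure_pathLaw [IsProbabilityMeasure μ] : IsProbabilityMeasure (pathLaw μ ξ) :=
  Measure.isProbabilityMeasure_map hξ.measurePreserving_path.aemeasurable

lemma measurePreserving_shift : MeasurePreserving shift (pathLaw μ ξ) (pathLaw μ ξ) :=
  ⟨measurable_pi_lambda _ fun _ => measurable_pi_apply _, hξ.stationary⟩

lemma measurePreserving_shift_iterate_path (n : ℕ) :
    MeasurePreserving (fun ω => shift^[n] (path ξ ω)) μ (pathLaw μ ξ) :=
  (hξ.measurePreserving_shift.iterate n).comp hξ.measurePreserving_path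

lemma map_eq (n : ℤ) : μ.map (ξ n) = μ.map (ξ 0) := by
  have key : ∀ n : ℤ, μ.map (ξ (n + 1)) = μ.map (ξ n) := fun n => by
    have h0 := hξ.measurePreserving_path
    have h1 := hξ.measurePreserving_shift.comp h0
    have hn : Measurable fun x : ℤ → S => x n := measurable_pi_apply n
    have e1 := congrArg (Measure.map fun x : ℤ → S => x n) (h1.map_eq.trans h0.map_eq.symm)
    rw [Measure.map_map hn h1.measurable, Measure.map_map hn h0.measurable] at e1
    exact e1
  induction n using Int.induction_on with
  | zero => rfl
  | succ n ih => rw [key, ih]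
  | pred n ih => rw [← ih, ← key (-(n : ℤ) - 1)]; simp

end

variable [IsProbabilityMeasure μ] (hξ : IsStationaryMarkovChain μ ξ) (hf : Measurable f)
  (hf2 : MemLp f 2 (μ.map (ξ 0)))
include hξ hf2

omit [IsProbabilityMeasure μ] in
lemma memLp_comp (n : ℤ) : MemLp (fun ω => f (ξ n ω)) 2 μ := by
  rw [← hξ.map_eq n] at hf2
  exact (memLp_map_measure_iff hf2.1 (hξ.measurable n).aemeasurable).1 hf2

omit [IsProbabilityMeasure μ] in
lemma memLp_block (a b : ℤ) : MemLp (block ξ f a b) 2 μ :=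
  memLp_finsetSum _ fun i _ => hξ.memLp_comp hf2 i

omit [IsProbabilityMeasure μ] in
lemma memLp_blockMean (a b : ℤ) : MemLp (blockMean μ ξ f a b) 2 μ :=
  (hξ.memLp_block hf2 a b).condExp (by norm_num)

omit [IsProbabilityMeasure μ] in
lemma memLp_blockDev (a b : ℤ) : MemLp (blockDev μ ξ f a b) 2 μ :=
  (hξ.memLp_block hf2 a b).sub (hξ.memLp_blockMean hf2 a b)

lemma integrable_blockDev (a b : ℤ) : Integrable (blockDev μ ξ f a b) μ :=
  (hξ.memLp_blockDev hf2 a b).integrable (by norm_num)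

lemma condExp_endpoints_blockDev (a b : ℤ) :
    μ[blockDev μ ξ f a b | present ξ a ⊔ present ξ b] =ᵐ[μ] 0 := by
  have hle : present ξ a ⊔ present ξ b ≤ mΩ := sup_le (hξ.present_le a) (hξ.present_le b)
  have hi : Integrable (block ξ f a b) μ := (hξ.memLp_block hf2 a b).integrable (by norm_num)
  refine (condExp_sub hi integrable_condExp _).trans ?_
  rw [condExp_of_stronglyMeasurable hle stronglyMeasurable_condExp integrable_condExp,
    sub_self]

include hf

lemma condExp_past_sup_window_blockDev {a b c : ℤ} (hab : a ≤ b) (hbc : b ≤ c) :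
    μ[blockDev μ ξ f a b | past ξ a ⊔ window ξ b c] =ᵐ[μ] 0 :=
  hξ.condExp_past_sup_window hab hbc (hξ.integrable_blockDev hf2 a b)
    (stronglyMeasurable_blockDev hf hab) (hξ.condExp_endpoints_blockDev hf2 a b)

/-- This makes the deviations of consecutive blocks martingale differences for the pasts of the left
endpoints. -/
lemma condExp_past_blockDev {a b : ℤ} (hab : a ≤ b) :
    μ[blockDev μ ξ f a b | past ξ a] =ᵐ[μ] 0 := by
  refine (condExp_condExp_of_le (le_sup_left (b := window ξ b b))
    (sup_le (hξ.past_le a) (hξ.window_le b b))).symm.trans ?_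
  refine (condExp_congr_ae (hξ.condExp_past_sup_window_blockDev hf hf2 hab le_rfl)).trans ?_
  rw [condExp_zero]

/-- Pythagoras' identity for the deviation of a block and a function of the rest of the chain. -/
lemma normSq_add_blockDev {a b c : ℤ} (hab : a ≤ b) (hbc : b ≤ c) {Z : Ω → ℝ} (hZ : MemLp Z 2 μ)
    (hZm : StronglyMeasurable[past ξ a ⊔ window ξ b c] Z) :
    normSq μ (Z + blockDev μ ξ f a b) = normSq μ Z + normSq μ (blockDev μ ξ f a b) := by
  have hY := hξ.memLp_blockDev hf2 a b
  have hYZ : Integrable (blockDev μ ξ f a b * Z) μ := hY.integrable_mul hZ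
  have h0 : ∫ ω, blockDev μ ξ f a b ω * Z ω ∂μ = 0 :=
    integral_smul_eq_zero_of_condExp_eq_zero (sup_le (hξ.past_le a) (hξ.window_le b c))
      (hξ.integrable_blockDev hf2 a b) hZm hYZ
      (hξ.condExp_past_sup_window_blockDev hf hf2 hab hbc)
  have e : ∀ ω, (Z + blockDev μ ξ f a b) ω ^ 2 =
      Z ω ^ 2 + blockDev μ ξ f a b ω ^ 2 + 2 * (blockDev μ ξ f a b ω * Z ω) := fun ω => by
    rw [Pi.add_apply]; ring
  simp only [normSq]
  simp_rw [e]
  have i1 : Integrable (fun ω => Z ω ^ 2 + blockDev μ ξ f a b ω ^ 2) μ :=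
    hZ.integrable_sq.add hY.integrable_sq
  have i2 : Integrable (fun ω => 2 * (blockDev μ ξ f a b ω * Z ω)) μ := hYZ.const_mul 2
  rw [integral_add i1 i2,
    integral_add hZ.integrable_sq hY.integrable_sq, integral_const_mul, h0]
  ring

lemma normSq_block {a b : ℤ} (hab : a ≤ b) :
    normSq μ (block ξ f a b) =
      normSq μ (blockMean μ ξ f a b) + normSq μ (blockDev μ ξ f a b) := by
  have h := hξ.normSq_add_blockDev hf hf2 hab le_rfl (hξ.memLp_blockMean hf2 a b)
    (stronglyMeasurable_blockMean.mono
      (sup_le_sup (present_le_past le_rfl) (present_le_window le_rfl le_rfl)))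
  rwa [blockMean_add_blockDev] at h

/-- Deviations of blocks from their conditional means are superadditive in `L²`. -/
lemma normSq_blockDev_add_le {a b c : ℤ} (hab : a ≤ b) (hbc : b ≤ c) :
    normSq μ (blockDev μ ξ f a b) + normSq μ (blockDev μ ξ f b c) ≤
      normSq μ (blockDev μ ξ f a c) := by
  -- `R` depends only on ξ_a, ξ_b, ξ_c, so Pythagoras' identity splits off the deviation of the
  -- right piece, then that of the left one; what is lost is the squared norm of `R`.
  set R : Ω → ℝ := blockMean μ ξ f a b + blockMean μ ξ f b c - blockMean μ ξ f a c
  have hR : MemLp R 2 μ := ((hξ.memLp_blockMean hf2 a b).add (hξ.memLp_blockMean hf2 b c)).sub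
    (hξ.memLp_blockMean hf2 a c)
  have hsplit : blockDev μ ξ f a c = R + blockDev μ ξ f a b + blockDev μ ξ f b c := by
    simp only [R, blockDev, ← block_add_block hab hbc]
    abel
  have hRm : ∀ m : MeasurableSpace Ω, present ξ a ≤ m → present ξ b ≤ m → present ξ c ≤ m →
      StronglyMeasurable[m] R := fun m ha hb hc =>
    (((stronglyMeasurable_blockMean (mΩ := mΩ)).mono (sup_le ha hb)).add
      ((stronglyMeasurable_blockMean (mΩ := mΩ)).mono (sup_le hb hc))).sub
      ((stronglyMeasurable_blockMean (mΩ := mΩ)).mono (sup_le ha hc))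
  have h1 : StronglyMeasurable[past ξ a ⊔ window ξ b c] R :=
    hRm _ ((present_le_past le_rfl).trans le_sup_left)
      ((present_le_window le_rfl hbc).trans le_sup_right)
      ((present_le_window hbc le_rfl).trans le_sup_right)
  have h2 : StronglyMeasurable[past ξ b ⊔ window ξ c c] (R + blockDev μ ξ f a b) := by
    refine (hRm _ ((present_le_past hab).trans le_sup_left)
      ((present_le_past le_rfl).trans le_sup_left)
      ((present_le_window le_rfl le_rfl).trans le_sup_right)).add ?_
    exact (stronglyMeasurable_blockDev hf hab).mono ((window_le_past a b).trans le_sup_left)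
  rw [hsplit, hξ.normSq_add_blockDev hf hf2 hbc le_rfl (hR.add (hξ.memLp_blockDev hf2 a b)) h2,
    hξ.normSq_add_blockDev hf hf2 hab hbc hR h1]
  linarith [normSq_nonneg (μ := μ) R]

/-- The deviations of consecutive blocks are orthogonal to each other and to the remainder of the
sum. -/
lemma normSq_block_sub_sum_blockDev (m u : ℕ) :
    normSq μ (block ξ f 0 ((u * m : ℕ) : ℤ)) =
      normSq μ (block ξ f 0 ((u * m : ℕ) : ℤ) - ∑ k ∈ Finset.range u,
        blockDev μ ξ f ((k * m : ℕ) : ℤ) (((k + 1) * m : ℕ) : ℤ)) +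
      ∑ k ∈ Finset.range u,
        normSq μ (blockDev μ ξ f ((k * m : ℕ) : ℤ) (((k + 1) * m : ℕ) : ℤ)) := by
  have hmono : ∀ {i j : ℕ}, i ≤ j → ((i * m : ℕ) : ℤ) ≤ ((j * m : ℕ) : ℤ) := fun h => by
    exact_mod_cast Nat.mul_le_mul_right m h
  have hblock : ∀ u : ℕ, block ξ f 0 ((u * m : ℕ) : ℤ) =
      ∑ k ∈ Finset.range u, block ξ f ((k * m : ℕ) : ℤ) (((k + 1) * m : ℕ) : ℤ) := fun u => by
    induction u with
    | zero => funext ω; simp [block]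
    | succ u ih =>
      rw [Finset.sum_range_succ, ← ih, block_add_block (by positivity) (hmono u.le_succ)]
  have hR : block ξ f 0 ((u * m : ℕ) : ℤ) - ∑ k ∈ Finset.range u,
        blockDev μ ξ f ((k * m : ℕ) : ℤ) (((k + 1) * m : ℕ) : ℤ) =
      ∑ k ∈ Finset.range u, blockMean μ ξ f ((k * m : ℕ) : ℤ) (((k + 1) * m : ℕ) : ℤ) := by
    rw [hblock, ← Finset.sum_sub_distrib]
    refine Finset.sum_congr rfl fun k _ => ?_
    simp [blockDev]
  set R := block ξ f 0 ((u * m : ℕ) : ℤ) - ∑ k ∈ Finset.range u,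
        blockDev μ ξ f ((k * m : ℕ) : ℤ) (((k + 1) * m : ℕ) : ℤ) with hRdef
  have hRL : MemLp R 2 μ := by
    rw [hR]
    exact memLp_finsetSum' _ fun k _ => hξ.memLp_blockMean hf2 _ _
  have hTL : ∀ j : ℕ, MemLp (∑ k ∈ Finset.range j,
      blockDev μ ξ f ((k * m : ℕ) : ℤ) (((k + 1) * m : ℕ) : ℤ)) 2 μ := fun j =>
    memLp_finsetSum' _ fun k _ => hξ.memLp_blockDev hf2 _ _
  -- The deviations are added back to `R` one at a time. `R` is a function of the chain at the block
  -- endpoints, none of which is strictly inside block `j`, and the earlier deviations belong to the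
  -- past of that block, so the new one is orthogonal to all of them.
  have key : ∀ j ≤ u, normSq μ (R + ∑ k ∈ Finset.range j,
        blockDev μ ξ f ((k * m : ℕ) : ℤ) (((k + 1) * m : ℕ) : ℤ)) = normSq μ R +
      ∑ k ∈ Finset.range j,
        normSq μ (blockDev μ ξ f ((k * m : ℕ) : ℤ) (((k + 1) * m : ℕ) : ℤ)) := by
    intro j
    induction j with
    | zero => simp
    | succ j ih =>
      intro hj
      rw [Finset.sum_range_succ, Finset.sum_range_succ, ← add_assoc, ← add_assoc,
        ← ih (by omega)]
      refine hξ.normSq_add_blockDev hf hf2 (hmono j.le_succ) (hmono hj) (hRL.add (hTL j)) ?_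
      refine StronglyMeasurable.add ?_ ?_
      · rw [hR]
        refine Finset.stronglyMeasurable_sum _ fun k hk => ?_
        have hk' := Finset.mem_range.1 hk
        refine stronglyMeasurable_blockMean.mono ?_
        have : ∀ i ≤ u, present ξ ((i * m : ℕ) : ℤ) ≤
            past ξ ((j * m : ℕ) : ℤ) ⊔ window ξ (((j + 1) * m : ℕ) : ℤ) ((u * m : ℕ) : ℤ) := by
          intro i hi
          rcases le_or_gt i j with h | h
          · exact (present_le_past (hmono h)).trans le_sup_left
          · exact (present_le_window (hmono h) (hmono hi)).trans le_sup_right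
        exact sup_le (this k (by omega)) (this (k + 1) (by omega))
      · refine Finset.stronglyMeasurable_sum _ fun k hk => ?_
        have hk' := Finset.mem_range.1 hk
        refine (stronglyMeasurable_blockDev hf (hmono k.le_succ)).mono ?_
        exact (window_le_past _ _).trans ((past_mono (hmono hk')).trans le_sup_left)
  have := key u le_rfl
  rwa [hRdef, sub_add_cancel] at this

/-- The deviation of a block is the value on the shifted path of a fixed function of paths. -/
lemma blockDev_ae_eq (a m : ℕ) :
    blockDev μ ξ f a ((a + m : ℕ) : ℤ) =ᵐ[μ] fun ω =>
      blockDev (pathLaw μ ξ) (fun k (x : ℤ → S) => x k) f 0 m (shift^[a] (path ξ ω)) := by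
  have hT := hξ.measurePreserving_shift_iterate_path a
  have := hξ.isProbabilityMeasure_pathLaw
  have hle : ∀ k : ℤ, present (fun k (x : ℤ → S) => x k) k ≤ MeasurableSpace.pi := fun k =>
    (measurable_pi_apply k).comap_le
  have hblock : block (fun k (x : ℤ → S) => x k) f 0 m ∘ (fun ω => shift^[a] (path ξ ω)) =
      block ξ f a ((a + m : ℕ) : ℤ) := by
    funext ω
    simp only [block, Function.comp_apply, shift_iterate_apply, path]
    refine Finset.sum_nbij' (· + (a : ℤ)) (· - (a : ℤ)) ?_ ?_ ?_ ?_ ?_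
    all_goals intro i hi
    all_goals simp only [Finset.mem_Ioc] at *
    all_goals push_cast at *
    all_goals omega
  have hcomap : (present (fun k (x : ℤ → S) => x k) 0 ⊔
      present (fun k (x : ℤ → S) => x k) m).comap (fun ω => shift^[a] (path ξ ω)) =
      present ξ a ⊔ present ξ ((a + m : ℕ) : ℤ) := by
    rw [MeasurableSpace.comap_sup, MeasurableSpace.comap_comp, MeasurableSpace.comap_comp]
    congr 2 <;> funext ω <;> simp [shift_iterate_apply, path, add_comm]
  have hint : Integrable (block (fun k (x : ℤ → S) => x k) f 0 m) (pathLaw μ ξ) := by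
    have hm : AEStronglyMeasurable (block (fun k (x : ℤ → S) => x k) f 0 m) (pathLaw μ ξ) :=
      (Finset.measurable_fun_sum _ fun i _ =>
        hf.comp (measurable_pi_apply i)).aestronglyMeasurable
    rw [← hT.integrable_comp hm, hblock]
    exact (hξ.memLp_block hf2 _ _).integrable (by norm_num)
  -- `Ω` itself carries no shift, so the conditional mean is computed once on path space and
  -- transported back along the shifted path map.
  have h := condExp_comp_measurePreserving hT (sup_le (hle 0) (hle m)) hint
  rw [hblock, hcomap] at h
  filter_upwards [h] with ω hω
  rw [blockDev, Pi.sub_apply, blockMean, ← hω, ← hblock]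
  rfl

lemma memLp_blockDev_pathLaw (m : ℕ) :
    MemLp (blockDev (pathLaw μ ξ) (fun k (x : ℤ → S) => x k) f 0 m) 2 (pathLaw μ ξ) := by
  have hT := hξ.measurePreserving_path
  have := hξ.isProbabilityMeasure_pathLaw
  have hm : AEStronglyMeasurable (blockDev (pathLaw μ ξ) (fun k (x : ℤ → S) => x k) f 0 m)
      (pathLaw μ ξ) :=
    (Finset.measurable_fun_sum _ fun i _ =>
      hf.comp (measurable_pi_apply i)).aestronglyMeasurable.sub integrable_condExp.1
  have h := hξ.memLp_blockDev hf2 (0 : ℕ) ((0 + m : ℕ) : ℤ)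
  rw [memLp_congr_ae (hξ.blockDev_ae_eq hf hf2 0 m)] at h
  rw [← hT.map_eq] at hm ⊢
  exact (memLp_map_measure_iff hm hT.measurable.aemeasurable).2 h

lemma normSq_blockDev (a m : ℕ) :
    normSq μ (blockDev μ ξ f a ((a + m : ℕ) : ℤ)) = normSq μ (blockDev μ ξ f 0 m) := by
  have key : ∀ a : ℕ, normSq μ (blockDev μ ξ f a ((a + m : ℕ) : ℤ)) =
      normSq (pathLaw μ ξ) (blockDev (pathLaw μ ξ) (fun k (x : ℤ → S) => x k) f 0 m) := fun a => by
    have hT := hξ.measurePreserving_shift_iterate_path a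
    have hm := (hξ.memLp_blockDev_pathLaw hf hf2 m).1
    rw [normSq_eq_of_ae (hξ.blockDev_ae_eq hf hf2 a m)]
    generalize blockDev (pathLaw μ ξ) (fun k (x : ℤ → S) => x k) f 0 m = h at hm ⊢
    rw [normSq, normSq, ← hT.map_eq]
    rw [← hT.map_eq] at hm
    exact (integral_map hT.measurable.aemeasurable (hm.pow 2)).symm
  have := key 0
  rw [zero_add] at this
  rw [key a, ← this]
  rfl

end IsStationaryMarkovChain

end Blocks

/-! ### The mean ergodic theorem, in L² and then in L¹ -/

section MeanErgodic

variable {X : Type*} [MeasurableSpace X] {P : Measure X}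

lemma integral_abs_sub_le_of_birkhoffSum {T : X → X} (hT : MeasurePreserving T P P) {h : X → ℝ}
    (hh : Integrable h P) (n : ℕ) :
    ∫ x, |∑ k ∈ Finset.range n, h (T^[k] x)| ∂P ≤ n * ∫ x, |h x| ∂P := by
  have hi : ∀ k, Integrable (fun x => h (T^[k] x)) P := fun k =>
    (hT.iterate k).integrable_comp_of_integrable hh
  have he : ∀ k, ∫ x, |h (T^[k] x)| ∂P = ∫ x, |h x| ∂P := fun k => by
    have hm := hh.abs.1
    have hTk := hT.iterate k
    rw [← hTk.map_eq] at hm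
    have := integral_map hTk.measurable.aemeasurable hm
    rw [hTk.map_eq] at this
    exact this.symm
  calc ∫ x, |∑ k ∈ Finset.range n, h (T^[k] x)| ∂P
      ≤ ∫ x, ∑ k ∈ Finset.range n, |h (T^[k] x)| ∂P :=
        integral_mono (integrable_finsetSum _ fun k _ => hi k).abs
          (integrable_finsetSum _ fun k _ => (hi k).abs) fun x => Finset.abs_sum_le_sum_abs _ _
    _ = n * ∫ x, |h x| ∂P := by
        rw [integral_finsetSum _ fun k _ => (hi k).abs]
        simp [he]

variable [IsProbabilityMeasure P]

lemma integral_abs_le_norm_Lp (F : Lp ℝ 2 P) : ∫ x, |F x| ∂P ≤ ‖F‖ := by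
  have hF := Lp.memLp F
  have h1 : ∫ x, |F x| ∂P = (eLpNorm F 1 P).toReal := by
    rw [eLpNorm_one_eq_lintegral_enorm, ← integral_norm_eq_lintegral_enorm hF.1]
    rfl
  rw [h1, Lp.norm_def]
  exact ENNReal.toReal_mono hF.2.ne (eLpNorm_le_eLpNorm_of_exponent_le (by norm_num) hF.1)

/-- The mean ergodic theorem in `L²`, with the error measured in `L¹`. -/
lemma exists_birkhoffSum_sub_integral_le_of_memLp {T : X → X} (hT : Ergodic T P) {g : X → ℝ}
    (hg : MemLp g 2 P) {ε : ℝ} (hε : 0 < ε) :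
    ∃ n : ℕ, 1 ≤ n ∧
      ∫ x, |∑ k ∈ Finset.range n, g (T^[k] x) - n * ∫ y, g y ∂P| ∂P ≤ ε * n := by
  have hTm := hT.toMeasurePreserving
  set U : Lp ℝ 2 P →ₗᵢ[ℝ] Lp ℝ 2 P := Lp.compMeasurePreservingₗᵢ ℝ T hTm
  have hlim := ContinuousLinearMap.tendsto_birkhoffAverage_orthogonalProjection
    U.toContinuousLinearMap U.norm_toContinuousLinearMap_le (hg.toLp g)
  obtain ⟨p, hp⟩ : ∃ p : Lp ℝ 2 P, p = ((U.toContinuousLinearMap.eqLocus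
    (1 : Lp ℝ 2 P →L[ℝ] Lp ℝ 2 P)).orthogonalProjectionOnto (hg.toLp g) : Lp ℝ 2 P) := ⟨_, rfl⟩
  rw [← hp] at hlim
  -- The von Neumann limit lies in the fixed space of the Koopman operator, so ergodicity forces it
  -- to be a constant `c`.
  have hUp : U p = p := by
    rw [hp]
    exact ((U.toContinuousLinearMap.eqLocus
      (1 : Lp ℝ 2 P →L[ℝ] Lp ℝ 2 P)).orthogonalProjectionOnto (hg.toLp g)).2
  obtain ⟨c, hc⟩ : ∃ c, p =ᵐ[P] Function.const X c := by
    refine hT.ae_eq_const_of_ae_eq_comp_ae (Lp.aestronglyMeasurable p) ?_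
    have := Lp.coeFn_compMeasurePreserving p hTm
    refine this.symm.trans (Eq.eventuallyEq ?_)
    exact congrArg (fun q : Lp ℝ 2 P => (q : X → ℝ)) hUp
  have hev : ∀ᶠ n : ℕ in atTop, 1 ≤ n ∧
      ‖birkhoffAverage ℝ U.toContinuousLinearMap _root_.id n (hg.toLp g) - p‖ < ε / 2 :=
    (eventually_ge_atTop 1).and
      ((tendsto_iff_norm_sub_tendsto_zero.1 hlim).eventually (gt_mem_nhds (half_pos hε)))
  obtain ⟨n, hn, hnorm⟩ := hev.exists
  have hn0 : (0 : ℝ) < n := by exact_mod_cast hn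
  have hsum : (birkhoffAverage ℝ U.toContinuousLinearMap _root_.id n
      (hg.toLp g) : Lp ℝ 2 P) =ᵐ[P]
      fun x => (n : ℝ)⁻¹ * ∑ k ∈ Finset.range n, g (T^[k] x) := by
    have hk : ∀ k, (U.toContinuousLinearMap^[k] (hg.toLp g) : X → ℝ) =ᵐ[P]
        fun x => g (T^[k] x) := fun k => by
      have h1 : U.toContinuousLinearMap^[k] (hg.toLp g) =
          (hg.comp_measurePreserving (hTm.iterate k)).toLp _ := by
        rw [← Lp.toLp_compMeasurePreserving hg (hTm.iterate k),
          ← Lp.compMeasurePreserving_iterate]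
        rfl
      rw [h1]
      exact MemLp.coeFn_toLp _
    rw [birkhoffAverage, birkhoffSum]
    filter_upwards [Lp.coeFn_smul (n : ℝ)⁻¹ (∑ k ∈ Finset.range n,
      _root_.id (U.toContinuousLinearMap^[k] (hg.toLp g))), Lp.coeFn_finsetSum (Finset.range n)
      fun k => _root_.id (U.toContinuousLinearMap^[k] (hg.toLp g)), ae_all_iff.2 hk]
      with x h1 h2 h3
    rw [h1, Pi.smul_apply, h2, Finset.sum_apply, smul_eq_mul]
    simp only [id_eq, h3]
  have hgi : Integrable g P := hg.integrable (by norm_num)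
  have hi : ∀ k, Integrable (fun x => g (T^[k] x)) P := fun k =>
    (hTm.iterate k).integrable_comp_of_integrable hgi
  have hI : Integrable (fun x => ∑ k ∈ Finset.range n, g (T^[k] x)) P :=
    integrable_finsetSum _ fun k _ => hi k
  have hint : ∫ x, ∑ k ∈ Finset.range n, g (T^[k] x) ∂P = n * ∫ y, g y ∂P := by
    rw [integral_finsetSum _ fun k _ => hi k]
    have : ∀ k, ∫ x, g (T^[k] x) ∂P = ∫ y, g y ∂P := fun k => by
      have hm := hgi.1
      have hTk := hTm.iterate k
      rw [← hTk.map_eq] at hm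
      have := integral_map hTk.measurable.aemeasurable hm
      rw [hTk.map_eq] at this
      exact this.symm
    simp [this]
  have hclose : ∫ x, |∑ k ∈ Finset.range n, g (T^[k] x) - n * c| ∂P ≤ ε / 2 * n := by
    have h1 := (integral_abs_le_norm_Lp _).trans hnorm.le
    have h2 : ∀ᵐ x ∂P, |(birkhoffAverage ℝ U.toContinuousLinearMap _root_.id n
        (hg.toLp g) - p : Lp ℝ 2 P) x| * n = |∑ k ∈ Finset.range n, g (T^[k] x) - n * c| := by
      filter_upwards [hsum, hc, Lp.coeFn_sub (birkhoffAverage ℝ U.toContinuousLinearMap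
        _root_.id n (hg.toLp g)) p] with x h1 h2 h3
      rw [h3, Pi.sub_apply, h1, h2, ← abs_of_pos hn0, ← abs_mul, abs_of_pos hn0]
      congr 1
      simp only [Function.const_apply]
      field_simp
    rw [← integral_congr_ae h2, integral_mul_const]
    gcongr
  -- Integrating the previous estimate identifies `c` with the mean of `g`, at the cost of another
  -- ε/2.
  have hcc : |n * c - n * ∫ y, g y ∂P| ≤ ε / 2 * n := by
    rw [← hint, abs_sub_comm]
    refine le_trans (le_of_eq ?_) ((abs_integral_le_integral_abs).trans hclose)
    rw [integral_sub hI (integrable_const _)]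
    simp
  refine ⟨n, hn, ?_⟩
  calc ∫ x, |∑ k ∈ Finset.range n, g (T^[k] x) - n * ∫ y, g y ∂P| ∂P
      ≤ ∫ x, (|∑ k ∈ Finset.range n, g (T^[k] x) - n * c| + |n * c - n * ∫ y, g y ∂P|) ∂P :=
        integral_mono (hI.sub (integrable_const _)).abs
          ((hI.sub (integrable_const _)).abs.add (integrable_const _)) fun x => abs_sub_le _ _ _
    _ = ∫ x, |∑ k ∈ Finset.range n, g (T^[k] x) - n * c| ∂P + |n * c - n * ∫ y, g y ∂P| := by
        have i1 : Integrable (fun x => |∑ k ∈ Finset.range n, g (T^[k] x) - n * c|) P :=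
          (hI.sub (integrable_const _)).abs
        rw [integral_add i1 (integrable_const _)]
        simp
    _ ≤ ε * n := by linarith

/-- The mean ergodic theorem in `L¹`. -/
lemma exists_birkhoffSum_sub_integral_le {T : X → X} (hT : Ergodic T P) {h : X → ℝ}
    (hh : Integrable h P) {ε : ℝ} (hε : 0 < ε) :
    ∃ n : ℕ, 1 ≤ n ∧
      ∫ x, |∑ k ∈ Finset.range n, h (T^[k] x) - n * ∫ y, h y ∂P| ∂P ≤ ε * n := by
  have hTm := hT.toMeasurePreserving
  -- A simple function within ε/3 in L¹ is square integrable. The two errors of replacing `h` by it,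
  -- in the sum and in the mean, and the L² theorem account for ε/3 each.
  obtain ⟨g, hg, hg1⟩ := (memLp_one_iff_integrable.2 hh).exists_simpleFunc_eLpNorm_sub_lt
    (by norm_num) (ε := ENNReal.ofReal (ε / 3)) (by simpa using hε)
  have hg2 : MemLp g 2 P := g.memLp_of_isFiniteMeasure 2 P
  have hgi : Integrable g P := hg2.integrable (by norm_num)
  have hd : Integrable (fun x => h x - g x) P := hh.sub hgi
  have hdist : ∫ x, |h x - g x| ∂P ≤ ε / 3 := by
    rw [eLpNorm_one_eq_lintegral_enorm] at hg
    have : ∫ x, |h x - g x| ∂P = (∫⁻ x, ‖(h - g) x‖ₑ ∂P).toReal :=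
      integral_norm_eq_lintegral_enorm hd.1
    rw [this]
    exact ENNReal.toReal_le_of_le_ofReal (by positivity) hg.le
  obtain ⟨n, hn, hgn⟩ := exists_birkhoffSum_sub_integral_le_of_memLp hT hg2
    (show 0 < ε / 3 by positivity)
  have hn0 : (0 : ℝ) < n := by exact_mod_cast hn
  have hi : ∀ {h : X → ℝ}, Integrable h P → Integrable (fun x => ∑ k ∈ Finset.range n,
      h (T^[k] x)) P := fun hh => integrable_finsetSum _ fun k _ =>
    (hTm.iterate k).integrable_comp_of_integrable hh
  have hc : |n * ∫ y, g y ∂P - n * ∫ y, h y ∂P| ≤ n * (ε / 3) := by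
    rw [← mul_sub, ← integral_sub hgi hh, abs_mul, abs_of_pos hn0]
    refine mul_le_mul_of_nonneg_left (abs_integral_le_integral_abs.trans ?_) hn0.le
    simpa only [abs_sub_comm] using hdist
  refine ⟨n, hn, ?_⟩
  calc ∫ x, |∑ k ∈ Finset.range n, h (T^[k] x) - n * ∫ y, h y ∂P| ∂P
      ≤ ∫ x, ((|∑ k ∈ Finset.range n, (h (T^[k] x) - g (T^[k] x))| +
          |∑ k ∈ Finset.range n, g (T^[k] x) - n * ∫ y, g y ∂P|) +
          |n * ∫ y, g y ∂P - n * ∫ y, h y ∂P|) ∂P := by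
        refine integral_mono ((hi hh).sub (integrable_const _)).abs
          (((hi hd).abs.add ((hi hgi).sub (integrable_const _)).abs).add
            (integrable_const _)) fun x => ?_
        simp only [Finset.sum_sub_distrib]
        refine (abs_sub_le _ (n * ∫ y, g y ∂P) _).trans ?_
        gcongr
        exact abs_sub_le _ _ _
    _ = ∫ x, |∑ k ∈ Finset.range n, (h (T^[k] x) - g (T^[k] x))| ∂P +
          ∫ x, |∑ k ∈ Finset.range n, g (T^[k] x) - n * ∫ y, g y ∂P| ∂P +
          |n * ∫ y, g y ∂P - n * ∫ y, h y ∂P| := by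
        have i2 : Integrable (fun x => |∑ k ∈ Finset.range n, g (T^[k] x) - n * ∫ y, g y ∂P|) P :=
          ((hi hgi).sub (integrable_const _)).abs
        have i12 := (hi hd).abs.add i2
        simp only [Pi.add_def] at i12
        rw [integral_add i12 (integrable_const _), integral_add (hi hd).abs i2]
        simp
    _ ≤ n * (ε / 3) + ε / 3 * n + n * (ε / 3) := by
        gcongr
        exact (integral_abs_sub_le_of_birkhoffSum hTm hd n).trans (by gcongr)
    _ = ε * n := by ring

end MeanErgodic

/-! ### Characteristic functions of sums of martingale differences -/

section MartingaleDifferences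

open Complex (I)

/-- The remainder of the second order Taylor expansion of `x ↦ exp (i x)` at `0`. -/
def expRem (x : ℝ) : ℂ := Complex.exp (x * I) - 1 - x * I + x ^ 2 / 2

lemma continuous_expRem : Continuous expRem := by
  unfold expRem
  fun_prop

lemma norm_expRem_le_cube {x : ℝ} (hx : |x| ≤ 1) : ‖expRem x‖ ≤ |x| ^ 3 := by
  have hn : ‖(x : ℂ) * I‖ = |x| := by simp
  have h := Complex.exp_bound (x := (x : ℂ) * I) (by rwa [hn]) (n := 3) (by norm_num)
  have e : expRem x = Complex.exp (x * I) -
      ∑ m ∈ Finset.range 3, ((x : ℂ) * I) ^ m / (m.factorial : ℂ) := by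
    simp only [expRem, Finset.sum_range_succ, Finset.sum_range_zero, Nat.factorial, mul_pow,
      Complex.I_sq]
    push_cast
    ring
  rw [e]
  refine h.trans ?_
  rw [hn]
  have : (0 : ℝ) ≤ |x| ^ 3 := by positivity
  norm_num [Nat.factorial]
  linarith

/-- The cubic bound near 0 gives pointwise decay of the rescaled remainder; this quadratic bound,
valid everywhere, provides the dominating function when only second moments exist. -/
lemma norm_expRem_le_sq (x : ℝ) : ‖expRem x‖ ≤ 4 * x ^ 2 := by
  rcases le_or_gt |x| 1 with h | h
  · refine (norm_expRem_le_cube h).trans ?_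
    have : |x| ^ 3 ≤ |x| ^ 2 := pow_le_pow_of_le_one (abs_nonneg x) h (by norm_num)
    rw [sq_abs] at this
    nlinarith [sq_nonneg x]
  · have h1 : ‖expRem x‖ ≤ 1 + 1 + |x| + x ^ 2 / 2 := by
      refine (norm_add_le _ _).trans (add_le_add ((norm_sub_le _ _).trans
        (add_le_add ((norm_sub_le _ _).trans (add_le_add ?_ ?_)) ?_)) ?_)
      · rw [Complex.norm_exp_ofReal_mul_I]
      · simp
      · simp
      · simp
    have h2 : x ^ 2 = |x| ^ 2 := (sq_abs x).symm
    nlinarith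

variable {Ω : Type*} {mΩ : MeasurableSpace Ω} {μ : Measure Ω}

lemma integrable_expRem {B : Ω → ℝ} (hB : MemLp B 2 μ) (τ : ℝ) :
    Integrable (fun ω => expRem (τ * B ω)) μ := by
  refine Integrable.mono' (g := fun ω => 4 * τ ^ 2 * B ω ^ 2) (hB.integrable_sq.const_mul _)
    (continuous_expRem.comp_aestronglyMeasurable (hB.1.const_mul τ)) (.of_forall fun ω => ?_)
  refine (norm_expRem_le_sq _).trans (le_of_eq ?_)
  ring

/-- The Taylor remainder of a square integrable variable scaled by `√n` is `o(1 / n)` in `L¹`. -/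
lemma tendsto_mul_integral_norm_expRem {B : Ω → ℝ} (hB : MemLp B 2 μ) (t : ℝ) :
    Tendsto (fun n : ℕ => (n : ℝ) * ∫ ω, ‖expRem (t / √n * B ω)‖ ∂μ) atTop (𝓝 0) := by
  have h := tendsto_integral_of_dominated_convergence (μ := μ)
    (F := fun (n : ℕ) ω => (n : ℝ) * ‖expRem (t / √n * B ω)‖) (f := fun _ => (0 : ℝ))
    (fun ω => 4 * t ^ 2 * B ω ^ 2) (fun n => ?_) (hB.integrable_sq.const_mul _) (fun n => ?_) ?_
  · simpa [integral_const_mul] using h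
  · exact ((integrable_expRem hB _).norm.const_mul _).1
  · refine .of_forall fun ω => ?_
    rw [norm_mul, norm_norm, Real.norm_natCast]
    rcases Nat.eq_zero_or_pos n with rfl | hn
    · simp; positivity
    have hn0 : (0 : ℝ) < n := by exact_mod_cast hn
    calc (n : ℝ) * ‖expRem (t / √n * B ω)‖ ≤ n * (4 * (t / √n * B ω) ^ 2) := by
          gcongr; exact norm_expRem_le_sq _
      _ = 4 * t ^ 2 * B ω ^ 2 := by
          rw [mul_pow, div_pow, Real.sq_sqrt hn0.le]
          field_simp
  · refine .of_forall fun ω => ?_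
    have hs : Tendsto (fun n : ℕ => √(n : ℝ)) atTop atTop :=
      Real.tendsto_sqrt_atTop.comp tendsto_natCast_atTop_atTop
    have hlim : Tendsto (fun n : ℕ => |t * B ω| ^ 3 / √(n : ℝ)) atTop (𝓝 0) :=
      tendsto_const_nhds.div_atTop hs
    refine squeeze_zero' (.of_forall fun n => by positivity) ?_ hlim
    filter_upwards [hs.eventually_ge_atTop |t * B ω|, eventually_gt_atTop 0] with n hn hn'
    have hn0 : (0 : ℝ) < n := by exact_mod_cast hn'
    have hs0 : 0 < √(n : ℝ) := Real.sqrt_pos.2 hn0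
    have e : t / √n * B ω = t * B ω / √n := by ring
    have habs : |t / √n * B ω| = |t * B ω| / √n := by
      rw [e, abs_div, abs_of_pos hs0]
    have hle : |t / √n * B ω| ≤ 1 := by
      rw [habs]
      exact (div_le_one hs0).2 hn
    refine (mul_le_mul_of_nonneg_left (norm_expRem_le_cube hle) hn0.le).trans (le_of_eq ?_)
    rw [habs, div_pow]
    have : (n : ℝ) = √n ^ 2 := (Real.sq_sqrt hn0.le).symm
    rw [this, Real.sqrt_sq hs0.le]
    field_simp

lemma abs_one_sub_sub_exp_neg_le {v : ℝ} (hv : 0 ≤ v) : |1 - v - Real.exp (-v)| ≤ v ^ 2 := by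
  have h1 := Real.add_one_le_exp (-v)
  rw [abs_sub_comm, abs_of_nonneg (by linarith)]
  rcases le_or_gt v 1 with h | h
  · have := (abs_le.1 (Real.abs_exp_sub_one_sub_id_le (x := -v)
      (by rwa [abs_neg, abs_of_nonneg hv]))).2
    nlinarith
  · have : Real.exp (-v) ≤ 1 := Real.exp_le_one_iff.2 (by linarith)
    nlinarith

variable {D : ℕ → Ω → ℝ} {ℱ : ℕ → MeasurableSpace Ω}

lemma memLp_sum_range (hD : ∀ k, MemLp (D k) 2 μ) (a l : ℕ) :
    MemLp (fun ω => ∑ k ∈ Finset.range l, D (a + k) ω) 2 μ :=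
  memLp_finsetSum _ fun _ _ => hD _

variable [IsProbabilityMeasure μ]

lemma integral_sum_smul_eq_zero (hmono : Monotone ℱ) (hle : ∀ k, ℱ k ≤ mΩ)
    (hD : ∀ k, MemLp (D k) 2 μ) (h0 : ∀ k, μ[D k | ℱ k] =ᵐ[μ] 0) {a : ℕ} {Z : Ω → ℂ}
    (hZ : StronglyMeasurable[ℱ a] Z) (hZ1 : ∀ ω, ‖Z ω‖ ≤ 1) (l : ℕ) :
    ∫ ω, (∑ k ∈ Finset.range l, D (a + k) ω) • Z ω ∂μ = 0 := by
  have hi : ∀ k, Integrable (fun ω => D k ω • Z ω) μ := fun k =>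
    ((hD k).integrable (by norm_num)).smul_bdd 1
      (hZ.mono (hle a)).aestronglyMeasurable (.of_forall hZ1)
  simp_rw [Finset.sum_smul]
  rw [integral_finsetSum _ fun k _ => hi _]
  refine Finset.sum_eq_zero fun k _ => ?_
  exact integral_smul_eq_zero_of_condExp_eq_zero (hle (a + k))
    ((hD _).integrable (by norm_num)) (hZ.mono (hmono (Nat.le_add_right a k))) (hi _) (h0 _)

/-- Each cross term is a difference times a bounded or square integrable factor known before it, so
it integrates to zero, even against the weight `Z`. -/
lemma integral_sq_sum_smul_eq (hmono : Monotone ℱ) (hle : ∀ k, ℱ k ≤ mΩ)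
    (hD : ∀ k, MemLp (D k) 2 μ) (hDm : ∀ k, StronglyMeasurable[ℱ (k + 1)] (D k))
    (h0 : ∀ k, μ[D k | ℱ k] =ᵐ[μ] 0) {a : ℕ} {Z : Ω → ℂ}
    (hZ : StronglyMeasurable[ℱ a] Z) (hZ1 : ∀ ω, ‖Z ω‖ ≤ 1) (l : ℕ) :
    ∫ ω, ((∑ k ∈ Finset.range l, D (a + k) ω) ^ 2) • Z ω ∂μ =
      ∫ ω, (∑ k ∈ Finset.range l, D (a + k) ω ^ 2) • Z ω ∂μ := by
  have hZs := (hZ.mono (hle a)).aestronglyMeasurable (μ := μ)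
  have hi : ∀ {F : Ω → ℝ}, Integrable F μ → Integrable (fun ω => F ω • Z ω) μ := fun hF =>
    hF.smul_bdd 1 hZs (.of_forall hZ1)
  induction l with
  | zero => simp
  | succ l ih =>
    have hB := memLp_sum_range hD a l
    have hx : Integrable (fun ω => D (a + l) ω * ∑ k ∈ Finset.range l, D (a + k) ω) μ :=
      (hD (a + l)).integrable_mul hB
    have hBm : StronglyMeasurable[ℱ (a + l)] fun ω => ∑ k ∈ Finset.range l, D (a + k) ω := by
      refine Finset.stronglyMeasurable_fun_sum _ fun k hk => (hDm _).mono (hmono ?_)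
      have := Finset.mem_range.1 hk
      omega
    have hcross : ∫ ω, (D (a + l) ω * ∑ k ∈ Finset.range l, D (a + k) ω) • Z ω ∂μ = 0 := by
      have h := integral_smul_eq_zero_of_condExp_eq_zero (hle (a + l))
        (Z := fun ω => (∑ k ∈ Finset.range l, D (a + k) ω) • Z ω) ((hD (a + l)).integrable (by norm_num))
        (hBm.smul (hZ.mono (hmono (Nat.le_add_right a l)))) ?_ (h0 _)
      · simpa only [smul_smul] using h
      · have := hi hx
        simp only [← smul_smul] at this
        exact this
    have e1 : ∀ ω, ((∑ k ∈ Finset.range (l + 1), D (a + k) ω) ^ 2) • Z ω =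
        ((∑ k ∈ Finset.range l, D (a + k) ω) ^ 2) • Z ω + (D (a + l) ω ^ 2) • Z ω +
        (2 : ℝ) • ((D (a + l) ω * ∑ k ∈ Finset.range l, D (a + k) ω) • Z ω) := fun ω => by
      rw [Finset.sum_range_succ, smul_smul, ← add_smul, ← add_smul]
      congr 1
      ring
    have e2 : ∀ ω, (∑ k ∈ Finset.range (l + 1), D (a + k) ω ^ 2) • Z ω =
        (∑ k ∈ Finset.range l, D (a + k) ω ^ 2) • Z ω + (D (a + l) ω ^ 2) • Z ω := fun ω => by
      rw [Finset.sum_range_succ, add_smul]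
    have i1 := hi hB.integrable_sq
    have i2 := hi (hD (a + l)).integrable_sq
    have i3 := hi (integrable_finsetSum (Finset.range l) fun k _ => (hD (a + k)).integrable_sq)
    have i12 := i1.add i2
    simp only [Pi.add_def] at i12
    have i4 := (hi hx).smul (2 : ℝ)
    simp only [Pi.smul_def] at i4
    simp_rw [e1, e2]
    rw [integral_add i12 i4, integral_add i1 i2, integral_smul, hcross,
      integral_add i3 i2, ih]
    simp

/-- The effect of one block of martingale differences on a characteristic function. -/
lemma norm_integral_mul_exp_sub_le (hmono : Monotone ℱ) (hle : ∀ k, ℱ k ≤ mΩ)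
    (hD : ∀ k, MemLp (D k) 2 μ) (hDm : ∀ k, StronglyMeasurable[ℱ (k + 1)] (D k))
    (h0 : ∀ k, μ[D k | ℱ k] =ᵐ[μ] 0) {a : ℕ} {Z : Ω → ℂ}
    (hZ : StronglyMeasurable[ℱ a] Z) (hZ1 : ∀ ω, ‖Z ω‖ ≤ 1) (l : ℕ) {s : ℝ} (hs : 0 ≤ s) (τ : ℝ) :
    ‖∫ ω, Z ω * Complex.exp ((τ * ∑ k ∈ Finset.range l, D (a + k) ω : ℝ) * I) ∂μ -
        Real.exp (-(τ ^ 2 * (l * s) / 2)) * ∫ ω, Z ω ∂μ‖ ≤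
      τ ^ 2 / 2 * ∫ ω, |∑ k ∈ Finset.range l, D (a + k) ω ^ 2 - l * s| ∂μ +
      ∫ ω, ‖expRem (τ * ∑ k ∈ Finset.range l, D (a + k) ω)‖ ∂μ + (τ ^ 2 * (l * s) / 2) ^ 2 := by
  have hZs := (hZ.mono (hle a)).aestronglyMeasurable (μ := μ)
  have hi : ∀ {F : Ω → ℝ}, Integrable F μ → Integrable (fun ω => F ω • Z ω) μ := fun hF =>
    hF.smul_bdd 1 hZs (.of_forall hZ1)
  have hB := memLp_sum_range hD a l
  have hQ := integrable_finsetSum (Finset.range l) fun k _ => (hD (a + k)).integrable_sq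
  have e0 := integral_sum_smul_eq_zero hmono hle hD h0 hZ hZ1 l
  have e1 := integral_sq_sum_smul_eq hmono hle hD hDm h0 hZ hZ1 l
  set B : Ω → ℝ := fun ω => ∑ k ∈ Finset.range l, D (a + k) ω
  set Q : Ω → ℝ := fun ω => ∑ k ∈ Finset.range l, D (a + k) ω ^ 2
  set v : ℝ := τ ^ 2 * (l * s) / 2 with hv
  have hv0 : 0 ≤ v := by positivity
  have iZ : Integrable Z μ := .of_bound hZs 1 (.of_forall hZ1)
  have ir : Integrable (fun ω => expRem (τ * B ω) * Z ω) μ :=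
    (integrable_expRem hB τ).mul_bdd (c := 1) hZs (.of_forall hZ1)
  have iB := hi (hB.integrable (by norm_num : (1 : ENNReal) ≤ 2))
  have iB2 := hi hB.integrable_sq
  have iQ := hi hQ
  -- Second order expansion. After integration the linear term vanishes, and in the quadratic one
  -- the square of the sum may be replaced by the sum of squares `Q`.
  have hexp : ∀ ω, Z ω * Complex.exp ((τ * B ω : ℝ) * I) =
      Z ω + (τ * I) * (B ω • Z ω) - (τ ^ 2 / 2) * (B ω ^ 2 • Z ω) + expRem (τ * B ω) * Z ω := by
    intro ω
    simp only [expRem, Complex.real_smul]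
    push_cast
    ring
  have hint : ∫ ω, Z ω * Complex.exp ((τ * B ω : ℝ) * I) ∂μ =
      ∫ ω, Z ω ∂μ - (τ ^ 2 / 2) * ∫ ω, Q ω • Z ω ∂μ + ∫ ω, expRem (τ * B ω) * Z ω ∂μ := by
    simp_rw [hexp]
    have j1 := iB.const_mul ((τ : ℂ) * I)
    have j2 := iB2.const_mul ((τ : ℂ) ^ 2 / 2)
    have j3 := iZ.add j1
    have j4 := j3.sub j2
    simp only [Pi.add_def, Pi.sub_def] at j3 j4
    rw [integral_add j4 ir, integral_sub j3 j2, integral_add iZ j1, integral_const_mul,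
      integral_const_mul, e1, e0, mul_zero, add_zero]
  have hQs : ∫ ω, (Q ω - l * s) • Z ω ∂μ = ∫ ω, Q ω • Z ω ∂μ - (l * s) * ∫ ω, Z ω ∂μ := by
    have iZs := iZ.smul (l * s : ℝ)
    simp only [Pi.smul_def] at iZs
    simp_rw [sub_smul]
    rw [integral_sub iQ iZs, integral_smul, Complex.real_smul]
    push_cast
    rfl
  -- The three errors: replacing `Q` by `l * s`, the Taylor remainder, and replacing 1 - v by
  -- exp(-v).
  have hdiff : ∫ ω, Z ω * Complex.exp ((τ * B ω : ℝ) * I) ∂μ - Real.exp (-v) * ∫ ω, Z ω ∂μ =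
      -((τ ^ 2 / 2 : ℝ) * ∫ ω, (Q ω - l * s) • Z ω ∂μ) + ∫ ω, expRem (τ * B ω) * Z ω ∂μ +
        (1 - v - Real.exp (-v) : ℝ) * ∫ ω, Z ω ∂μ := by
    rw [hint, hQs, hv]
    push_cast
    ring
  rw [hdiff]
  refine (norm_add₃_le).trans (add_le_add_three ?_ ?_ ?_)
  · rw [norm_neg, norm_mul, Complex.norm_real, Real.norm_of_nonneg (by positivity)]
    gcongr
    refine norm_integral_le_of_norm_le (hQ.sub (integrable_const _)).abs (.of_forall fun ω => ?_)
    rw [norm_smul]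
    exact mul_le_of_le_one_right (norm_nonneg _) (hZ1 ω)
  · refine norm_integral_le_of_norm_le (integrable_expRem hB τ).norm (.of_forall fun ω => ?_)
    rw [norm_mul]
    exact mul_le_of_le_one_right (norm_nonneg _) (hZ1 ω)
  · rw [norm_mul, Complex.norm_real]
    have h1 : ‖∫ ω, Z ω ∂μ‖ ≤ 1 := by
      refine (norm_integral_le_of_norm_le (integrable_const (1 : ℝ)) (.of_forall hZ1)).trans ?_
      simp
    exact (mul_le_of_le_one_right (norm_nonneg _) h1).trans (abs_one_sub_sub_exp_neg_le hv0)

/-- The characteristic function of a sum of martingale differences, cut into `u` blocks of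
length `l`, is close to a Gaussian one. -/
lemma norm_integral_exp_sum_sub_le (hmono : Monotone ℱ) (hle : ∀ k, ℱ k ≤ mΩ)
    (hD : ∀ k, MemLp (D k) 2 μ) (hDm : ∀ k, StronglyMeasurable[ℱ (k + 1)] (D k))
    (h0 : ∀ k, μ[D k | ℱ k] =ᵐ[μ] 0) {l : ℕ} {s τ α β : ℝ} (hs : 0 ≤ s)
    (hα : ∀ j, ∫ ω, |∑ k ∈ Finset.range l, D (j * l + k) ω ^ 2 - l * s| ∂μ ≤ α)
    (hβ : ∀ j, ∫ ω, ‖expRem (τ * ∑ k ∈ Finset.range l, D (j * l + k) ω)‖ ∂μ ≤ β) (u : ℕ) :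
    ‖∫ ω, Complex.exp ((τ * ∑ k ∈ Finset.range (u * l), D k ω : ℝ) * I) ∂μ -
        Real.exp (-(u * (τ ^ 2 * (l * s) / 2)))‖ ≤
      u * (τ ^ 2 / 2 * α + β + (τ ^ 2 * (l * s) / 2) ^ 2) := by
  induction u with
  | zero => simp
  | succ u ih =>
    set v : ℝ := τ ^ 2 * (l * s) / 2 with hv
    have hv0 : 0 ≤ v := by positivity
    set Z : Ω → ℂ := fun ω =>
      Complex.exp ((τ * ∑ k ∈ Finset.range (u * l), D k ω : ℝ) * I) with hZdef
    have hSm : StronglyMeasurable[ℱ (u * l)] fun ω =>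
        τ * ∑ k ∈ Finset.range (u * l), D k ω := by
      refine (Finset.stronglyMeasurable_fun_sum _ fun k hk => (hDm k).mono (hmono ?_)).const_mul τ
      exact Finset.mem_range.1 hk
    have hZ : StronglyMeasurable[ℱ (u * l)] Z :=
      (show Continuous fun x : ℝ => Complex.exp (x * I) by fun_prop).comp_stronglyMeasurable hSm
    have hZ1 : ∀ ω, ‖Z ω‖ ≤ 1 := fun ω => (Complex.norm_exp_ofReal_mul_I _).le
    have hstep := norm_integral_mul_exp_sub_le hmono hle hD hDm h0 hZ hZ1 l hs τ
    have hsplit : ∀ ω, Complex.exp ((τ * ∑ k ∈ Finset.range ((u + 1) * l), D k ω : ℝ) * I) =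
        Z ω * Complex.exp ((τ * ∑ k ∈ Finset.range l, D (u * l + k) ω : ℝ) * I) := fun ω => by
      rw [hZdef, ← Complex.exp_add, ← add_mul, ← Complex.ofReal_add, ← mul_add,
        ← Finset.sum_range_add, add_mul, one_mul]
    simp_rw [hsplit]
    have hE : ((Real.exp (-((u + 1 : ℕ) * v)) : ℝ) : ℂ) =
        Real.exp (-v) * Real.exp (-(u * v)) := by
      rw [← Complex.ofReal_mul, ← Real.exp_add]
      congr 2
      push_cast
      ring
    rw [hE]
    have hv1 : Real.exp (-v) ≤ 1 := Real.exp_le_one_iff.2 (by linarith)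
    -- The last group is compared with the factor exp(-v), `Z` carrying the earlier groups. As
    -- exp(-v) ≤ 1, the accumulated error is not amplified.
    calc _ ≤ ‖∫ ω, Z ω * Complex.exp ((τ * ∑ k ∈ Finset.range l, D (u * l + k) ω : ℝ) * I) ∂μ -
            Real.exp (-v) * ∫ ω, Z ω ∂μ‖ +
          ‖(Real.exp (-v) : ℂ) * ∫ ω, Z ω ∂μ - Real.exp (-v) * Real.exp (-(u * v))‖ :=
          norm_sub_le_norm_sub_add_norm_sub _ _ _
      _ ≤ (τ ^ 2 / 2 * α + β + v ^ 2) + u * (τ ^ 2 / 2 * α + β + v ^ 2) := by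
          refine add_le_add (hstep.trans ?_) ?_
          · gcongr
            · exact hα u
            · exact hβ u
          · rw [← mul_sub, norm_mul, Complex.norm_real, Real.norm_of_nonneg (Real.exp_pos _).le]
            exact (mul_le_of_le_one_left (norm_nonneg _) hv1).trans ih
      _ = _ := by push_cast; ring

end MartingaleDifferences

/-! ### Elementary estimates and limits -/

section Limits

open Complex (I)

lemma norm_exp_mul_I_sub_exp_mul_I_le (x y : ℝ) :
    ‖Complex.exp (x * I) - Complex.exp (y * I)‖ ≤ |x - y| := by
  have e : Complex.exp (x * I) - Complex.exp (y * I) =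
      Complex.exp (y * I) * (Complex.exp (I * ((x - y : ℝ) : ℂ)) - 1) := by
    rw [mul_sub, ← Complex.exp_add, mul_one]
    congr 2
    push_cast
    ring
  rw [e, norm_mul, Complex.norm_exp_ofReal_mul_I, one_mul]
  exact Real.norm_exp_I_mul_ofReal_sub_one_le

/-- The largest multiple of `N` below `n` is asymptotic to `n`. -/
lemma tendsto_div_mul_div (N : ℕ) (hN : 0 < N) :
    Tendsto (fun n : ℕ => ((n / N * N : ℕ) : ℝ) / n) atTop (𝓝 1) := by
  have h1 : Tendsto (fun n : ℕ => 1 - (N : ℝ) / n) atTop (𝓝 (1 - 0)) :=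
    tendsto_const_nhds.sub (tendsto_const_nhds.div_atTop tendsto_natCast_atTop_atTop)
  rw [sub_zero] at h1
  refine tendsto_of_tendsto_of_tendsto_of_le_of_le' h1 tendsto_const_nhds ?_ ?_
  · filter_upwards [eventually_gt_atTop 0] with n hn
    have hn0 : (0 : ℝ) < n := by exact_mod_cast hn
    rw [le_div_iff₀ hn0, sub_mul, div_mul_cancel₀ _ hn0.ne', one_mul]
    have h2 : (n : ℝ) ≤ ((n / N * N : ℕ) : ℝ) + N := by
      have := Nat.div_add_mod n N
      have := Nat.mod_lt n hN
      exact_mod_cast (by rw [mul_comm]; omega : n ≤ n / N * N + N)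
    linarith
  · filter_upwards [eventually_gt_atTop 0] with n hn
    have hn0 : (0 : ℝ) < n := by exact_mod_cast hn
    rw [div_le_one hn0]
    exact_mod_cast Nat.div_mul_le_self n N

lemma tendsto_div_mul_atTop (N : ℕ) (hN : 0 < N) :
    Tendsto (fun n : ℕ => n / N * N) atTop atTop := by
  refine tendsto_atTop_mono (fun n => ?_) (tendsto_sub_atTop_nat N)
  have := Nat.div_add_mod n N
  have := Nat.mod_lt n hN
  rw [mul_comm]
  omega

end Limits

/-! ### Martingale approximation and the limit theorem for the chain -/

section CLT

open Complex (I)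

variable {Ω S : Type*} [mΩ : MeasurableSpace Ω] [MeasurableSpace S] {μ : Measure Ω}
  [IsProbabilityMeasure μ] {ξ : ℤ → Ω → S} {f : S → ℝ}

lemma integral_abs_le_sqrt_normSq {X : Ω → ℝ} (hX : MemLp X 2 μ) :
    ∫ ω, |X ω| ∂μ ≤ √(normSq μ X) := by
  refine Real.le_sqrt_of_sq_le ?_
  have h := variance_nonneg |X| μ
  rw [variance_eq_sub hX.abs] at h
  have e : ∫ ω, (|X| ^ 2) ω ∂μ = normSq μ X :=
    integral_congr_ae (.of_forall fun ω => sq_abs _)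
  rw [e] at h
  exact sub_nonneg.1 h

namespace IsStationaryMarkovChain

variable (hξ : IsStationaryMarkovChain μ ξ) (hf : Measurable f)
  (hf2 : MemLp f 2 (μ.map (ξ 0)))

include hξ

omit [IsProbabilityMeasure μ] in
lemma integral_comp_shift_iterate_path (n : ℕ) {Φ : (ℤ → S) → ℝ}
    (hΦ : AEStronglyMeasurable Φ (pathLaw μ ξ)) :
    ∫ ω, Φ (shift^[n] (path ξ ω)) ∂μ = ∫ x, Φ x ∂(pathLaw μ ξ) := by
  have hT := hξ.measurePreserving_shift_iterate_path n
  have h := integral_map hT.measurable.aemeasurable (f := Φ) (by rwa [hT.map_eq])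
  rw [hT.map_eq] at h
  exact h.symm

include hf2

omit [IsProbabilityMeasure μ] in
-- A crude Cauchy–Schwarz bound, enough for the incomplete stretch at the end of the sum, whose
-- length stays bounded.
lemma normSq_block_le (a b : ℕ) :
    normSq μ (block ξ f a b) ≤ ((b - a : ℕ) : ℝ) ^ 2 * ∫ x, f x ^ 2 ∂(μ.map (ξ 0)) := by
  have hi : ∀ i : ℤ, ∫ ω, f (ξ i ω) ^ 2 ∂μ = ∫ x, f x ^ 2 ∂(μ.map (ξ 0)) := fun i => by
    have := hξ.map_eq i
    rw [← this] at hf2 ⊢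
    exact (integral_map (hξ.measurable i).aemeasurable (hf2.1.pow 2)).symm
  have hcard : ((Finset.Ioc (a : ℤ) b).card : ℝ) = ((b - a : ℕ) : ℝ) := by
    rw [Int.card_Ioc]
    congr 1
    omega
  calc normSq μ (block ξ f a b)
      ≤ ∫ ω, (Finset.Ioc (a : ℤ) b).card * ∑ i ∈ Finset.Ioc (a : ℤ) b, f (ξ i ω) ^ 2 ∂μ := by
        refine integral_mono (hξ.memLp_block hf2 _ _).integrable_sq
          ((integrable_finsetSum _ fun i _ => (hξ.memLp_comp hf2 i).integrable_sq).const_mul _)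
          fun ω => ?_
        exact sq_sum_le_card_mul_sum_sq
    _ = _ := by
        rw [integral_const_mul,
          integral_finsetSum _ fun i _ => (hξ.memLp_comp hf2 i).integrable_sq]
        simp only [hi, Finset.sum_const, nsmul_eq_mul, hcard]
        ring

include hf

lemma normSq_block_sub_sum_blockDev_eq (m u : ℕ) :
    normSq μ (block ξ f 0 ((u * m : ℕ) : ℤ) - ∑ k ∈ Finset.range u,
        blockDev μ ξ f ((k * m : ℕ) : ℤ) (((k + 1) * m : ℕ) : ℤ)) =
      normSq μ (block ξ f 0 ((u * m : ℕ) : ℤ)) - u * normSq μ (blockDev μ ξ f 0 m) := by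
  have h := hξ.normSq_block_sub_sum_blockDev hf hf2 m u
  have e : ∀ k : ℕ, normSq μ (blockDev μ ξ f ((k * m : ℕ) : ℤ) (((k + 1) * m : ℕ) : ℤ)) =
      normSq μ (blockDev μ ξ f 0 m) := fun k => by
    rw [Nat.succ_mul]
    exact hξ.normSq_blockDev hf hf2 (k * m) m
  simp only [e, Finset.sum_const, Finset.card_range, nsmul_eq_mul] at h
  linarith

/-- The characteristic function of the sum of the deviations of consecutive blocks. -/
lemma norm_integral_exp_sum_blockDev_sub_le (herg : IsTotallyErgodic μ ξ) {m : ℕ} (hm : 1 ≤ m)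
    {ε : ℝ} (hε : 0 < ε) (t : ℝ) : ∃ (L : ℕ) (β : ℕ → ℝ), 1 ≤ L ∧ (∀ n, 0 ≤ β n) ∧
      Tendsto (fun n : ℕ => n * β n) atTop (𝓝 0) ∧ ∀ n u : ℕ,
      ‖∫ ω, Complex.exp ((t / √n * ∑ k ∈ Finset.range (u * L),
          blockDev μ ξ f ((k * m : ℕ) : ℤ) (((k + 1) * m : ℕ) : ℤ) ω : ℝ) * I) ∂μ -
        Real.exp (-(u * ((t / √n) ^ 2 * (L * normSq μ (blockDev μ ξ f 0 m)) / 2)))‖ ≤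
      u * ((t / √n) ^ 2 / 2 * (ε * L) + β n +
        ((t / √n) ^ 2 * (L * normSq μ (blockDev μ ξ f 0 m)) / 2) ^ 2) := by
  have := hξ.isProbabilityMeasure_pathLaw
  set P := pathLaw μ ξ with hP
  set T : (ℤ → S) → ℤ → S := shift^[m] with hT
  set h : (ℤ → S) → ℝ := blockDev P (fun k (x : ℤ → S) => x k) f 0 m with hh
  have hTerg : Ergodic T P := herg m hm
  have hTm := hTerg.toMeasurePreserving
  have hh2 : MemLp h 2 P := hξ.memLp_blockDev_pathLaw hf hf2 m
  set D : ℕ → Ω → ℝ := fun k =>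
    blockDev μ ξ f ((k * m : ℕ) : ℤ) (((k + 1) * m : ℕ) : ℤ) with hDdef
  have hDh : ∀ k, D k =ᵐ[μ] fun ω => h (T^[k] (path ξ ω)) := fun k => by
    have := hξ.blockDev_ae_eq hf hf2 (k * m) m
    rw [mul_comm k m, Function.iterate_mul, ← mul_comm k m, ← Nat.succ_mul] at this
    exact this
  have hs : ∫ x, h x ^ 2 ∂P = normSq μ (blockDev μ ξ f 0 m) := by
    have h0 := hξ.integral_comp_shift_iterate_path 0 (hh2.1.pow 2)
    have h1 := normSq_eq_of_ae (hξ.blockDev_ae_eq hf hf2 0 m)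
    rw [zero_add] at h1
    exact h0.symm.trans h1.symm
  obtain ⟨L, hL, hLε⟩ := exists_birkhoffSum_sub_integral_le hTerg hh2.integrable_sq hε
  have hB : MemLp (fun x => ∑ k ∈ Finset.range L, h (T^[k] x)) 2 P :=
    memLp_finsetSum _ fun k _ => hh2.comp_measurePreserving (hTm.iterate k)
  have hblock : ∀ j, ∀ᵐ ω ∂μ, ∀ k, D (j * L + k) ω =
      h (T^[k] (shift^[m * (j * L)] (path ξ ω))) := fun j => by
    filter_upwards [ae_all_iff.2 hDh] with ω hω k
    rw [hω, Function.iterate_mul, ← hT, ← Function.iterate_add_apply, add_comm]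
  -- By stationarity the Taylor remainder has the same integral over every group of `L` deviations,
  -- so one integral on path space serves as β for all groups.
  refine ⟨L, fun n => ∫ x, ‖expRem (t / √n * ∑ k ∈ Finset.range L, h (T^[k] x))‖ ∂P, hL,
    fun n => integral_nonneg fun _ => norm_nonneg _, tendsto_mul_integral_norm_expRem hB t,
    fun n u => ?_⟩
  have hmono : ∀ {i j : ℕ}, i ≤ j → ((i * m : ℕ) : ℤ) ≤ ((j * m : ℕ) : ℤ) := fun h => by
    exact_mod_cast Nat.mul_le_mul_right m h
  refine norm_integral_exp_sum_sub_le (D := D) (ℱ := fun k => past ξ ((k * m : ℕ) : ℤ))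
    (fun i j hij => past_mono (hmono hij)) (fun k => hξ.past_le _)
    (fun k => hξ.memLp_blockDev hf2 _ _)
    (fun k => (stronglyMeasurable_blockDev hf (hmono k.le_succ)).mono (window_le_past _ _))
    (fun k => hξ.condExp_past_blockDev hf hf2 (hmono k.le_succ)) (normSq_nonneg _)
    (fun j => ?_) (fun j => ?_) u
  · rw [← hs]
    refine le_trans (le_of_eq ?_) hLε
    have hΦ : AEStronglyMeasurable
        (fun x => |∑ k ∈ Finset.range L, h (T^[k] x) ^ 2 - L * ∫ y, h y ^ 2 ∂P|) P :=
      ((integrable_finsetSum _ fun k _ =>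
        (hh2.comp_measurePreserving (hTm.iterate k)).integrable_sq).sub (integrable_const _)).abs.1
    refine Eq.trans (integral_congr_ae ?_)
      (hξ.integral_comp_shift_iterate_path (m * (j * L)) hΦ)
    filter_upwards [hblock j] with ω hω
    simp only [hω]
  · refine le_of_eq ?_
    refine Eq.trans (integral_congr_ae ?_) (hξ.integral_comp_shift_iterate_path (m * (j * L))
      (integrable_expRem hB (t / √n)).norm.1)
    filter_upwards [hblock j] with ω hω
    simp only [hω]

/-- The distance between the characteristic function of `S_n / √n` and that of `N(0, v)`, in terms
of the block length `m`. -/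
lemma eventually_norm_integral_exp_block_sub_le (herg : IsTotallyErgodic μ ξ) {v : ℝ}
    (hv : Tendsto (fun n : ℕ => normSq μ (block ξ f 0 n) / n) atTop (𝓝 v)) {m : ℕ} (hm : 1 ≤ m)
    {ε δ : ℝ} (hε : 0 < ε) (hδ : 0 < δ) (t : ℝ) :
    ∀ᶠ n : ℕ in atTop,
      ‖∫ ω, Complex.exp ((t / √n * block ξ f 0 n ω : ℝ) * I) ∂μ - Real.exp (-(t ^ 2 / 2 * v))‖ ≤
      |t| * √(v - normSq μ (blockDev μ ξ f 0 m) / m) + t ^ 2 * ε / 2 +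
        |Real.exp (-(t ^ 2 / 2 * (normSq μ (blockDev μ ξ f 0 m) / m))) -
          Real.exp (-(t ^ 2 / 2 * v))| + δ := by
  obtain ⟨L, β, hL, hβ0, hβ, hmart⟩ :=
    hξ.norm_integral_exp_sum_blockDev_sub_le hf hf2 herg hm hε t
  set s : ℝ := normSq μ (blockDev μ ξ f 0 m) with hs
  have hs0 : 0 ≤ s := normSq_nonneg _
  set c : ℝ := ∫ x, f x ^ 2 ∂(μ.map (ξ 0)) with hc
  have hc0 : 0 ≤ c := integral_nonneg fun _ => sq_nonneg _
  -- A group of `L` blocks of length `m` covers `N` indices. The sum is cut at `W n`, the largest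
  -- multiple of `N` not exceeding `n`.
  set N : ℕ := L * m with hN
  have hN0 : 0 < N := Nat.mul_pos hL hm
  have hm0 : (0 : ℝ) < m := by exact_mod_cast hm
  set W : ℕ → ℕ := fun n => n / N * N with hW
  set ρ : ℕ → ℝ := fun n => (W n : ℝ) / n with hρ
  have hρ1 : Tendsto ρ atTop (𝓝 1) := tendsto_div_mul_div N hN0
  have hWt : Tendsto W atTop atTop := tendsto_div_mul_atTop N hN0
  have hnW : Tendsto (fun n => normSq μ (block ξ f 0 (W n)) / n) atTop (𝓝 v) := by
    have h1 := (hv.comp hWt).mul hρ1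
    rw [mul_one] at h1
    refine h1.congr' ?_
    filter_upwards [hWt.eventually_gt_atTop 0] with n hn
    have hn0 : (W n : ℝ) ≠ 0 := by exact_mod_cast hn.ne'
    simp only [Function.comp_apply, hρ]
    field_simp
  -- The error bound at `n`: the final stretch and the non-martingale remainder, the Gaussian
  -- approximation of the martingale, and the gap between the two Gaussian values. Its limit is the
  -- stated bound without δ.
  set G : ℕ → ℝ := fun n => |t| * (√((N : ℝ) ^ 2 * c / n) +
      √(normSq μ (block ξ f 0 (W n)) / n - ρ n * (s / m))) +
    (t ^ 2 * ε / 2 + n * β n + (t ^ 2 * (L * s) / 2) ^ 2 / n) +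
    |Real.exp (-(t ^ 2 / 2 * (s / m) * ρ n)) - Real.exp (-(t ^ 2 / 2 * v))| with hG
  have hGlim : Tendsto G atTop (𝓝 (|t| * √(v - s / m) + t ^ 2 * ε / 2 +
      |Real.exp (-(t ^ 2 / 2 * (s / m))) - Real.exp (-(t ^ 2 / 2 * v))|)) := by
    have hdiv : ∀ x : ℝ, Tendsto (fun n : ℕ => x / n) atTop (𝓝 0) := fun x =>
      tendsto_const_nhds.div_atTop tendsto_natCast_atTop_atTop
    have h1 := (hdiv ((N : ℝ) ^ 2 * c)).sqrt
    have h2 := (hnW.sub (hρ1.mul_const (s / m))).sqrt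
    have h3 := (tendsto_const_nhds (x := t ^ 2 * ε / 2)).add hβ |>.add
      (hdiv ((t ^ 2 * (L * s) / 2) ^ 2))
    have h4 := (((Real.continuous_exp.tendsto _).comp
      (hρ1.const_mul (t ^ 2 / 2 * (s / m))).neg).sub_const (Real.exp (-(t ^ 2 / 2 * v)))).abs
    have h5 := (((h1.add h2).const_mul |t|).add h3).add h4
    simp only [Real.sqrt_zero, zero_add, add_zero, one_mul, mul_one] at h5
    exact h5
  filter_upwards [hGlim.eventually (gt_mem_nhds (lt_add_of_pos_right _ hδ)),
    eventually_gt_atTop 0] with n hn hn'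
  refine le_trans ?_ hn.le
  have hn0 : (0 : ℝ) < n := by exact_mod_cast hn'
  have hsq0 : 0 < √(n : ℝ) := Real.sqrt_pos.2 hn0
  set u : ℕ := n / N with hu
  have hWn : W n = u * L * m := by rw [hW, mul_assoc]
  have hρn : ρ n = (W n : ℝ) / n := rfl
  have hWle : W n ≤ n := Nat.div_mul_le_self n N
  have huL : (u : ℝ) * L * m = W n := by rw [hWn]; push_cast; ring
  have huLn : (u : ℝ) * L ≤ n := by
    have : u * L ≤ n := (Nat.le_mul_of_pos_right _ hm).trans (hWn ▸ hWle)
    exact_mod_cast this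
  have hun : (u : ℝ) ≤ n := by exact_mod_cast Nat.div_le_self n N
  set M : Ω → ℝ := ∑ k ∈ Finset.range (u * L),
    blockDev μ ξ f ((k * m : ℕ) : ℤ) (((k + 1) * m : ℕ) : ℤ) with hM
  have hML : MemLp M 2 μ := memLp_finsetSum' _ fun k _ => hξ.memLp_blockDev hf2 _ _
  have hSL : MemLp (block ξ f 0 n) 2 μ := hξ.memLp_block hf2 _ _
  have hRL : MemLp (block ξ f 0 (W n) - M) 2 μ := (hξ.memLp_block hf2 _ _).sub hML
  have hEL : MemLp (block ξ f (W n) n) 2 μ := hξ.memLp_block hf2 _ _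
  have hR : normSq μ (block ξ f 0 (W n) - M) / n =
      normSq μ (block ξ f 0 (W n)) / n - ρ n * (s / m) := by
    have h1 := hξ.normSq_block_sub_sum_blockDev_eq hf hf2 m (u * L)
    rw [← hWn, ← hM] at h1
    rw [h1, hρn, ← huL, ← hs]
    push_cast
    field_simp
  have hE : normSq μ (block ξ f (W n) n) / n ≤ (N : ℝ) ^ 2 * c / n := by
    gcongr
    refine (hξ.normSq_block_le hf2 (W n) n).trans ?_
    have h1 : n - W n ≤ N := by
      have h2 := Nat.div_add_mod n N
      have h3 := Nat.mod_lt n hN0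
      have h4 : W n = N * (n / N) := mul_comm _ _
      omega
    have h2 : ((n - W n : ℕ) : ℝ) ≤ N := by exact_mod_cast h1
    gcongr
  have hdist : ∫ ω, |block ξ f 0 n ω - M ω| ∂μ ≤
      √(normSq μ (block ξ f (W n) n)) + √(normSq μ (block ξ f 0 (W n) - M)) := by
    have i1 := (hEL.integrable (by norm_num : (1 : ENNReal) ≤ 2)).abs
    have i2 := (hRL.integrable (by norm_num : (1 : ENNReal) ≤ 2)).abs
    refine le_trans ?_ (add_le_add (integral_abs_le_sqrt_normSq hEL)
      (integral_abs_le_sqrt_normSq hRL))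
    rw [← integral_add i1 i2]
    refine integral_mono ((hSL.sub hML).integrable (by norm_num)).abs (i1.add i2) fun ω => ?_
    have h1 : block ξ f 0 n ω = block ξ f 0 (W n) ω + block ξ f (W n) n ω :=
      (congrFun (block_add_block (ξ := ξ) (f := f) (Int.natCast_nonneg (W n))
        (Int.ofNat_le.2 hWle)) ω).symm
    have h2 : block ξ f 0 n ω - M ω =
        block ξ f (W n) n ω + (block ξ f 0 (W n) - M) ω := by
      rw [h1, Pi.sub_apply]; ring
    simp only [h2]
    exact abs_add_le _ _
  have hexp : ∀ {X : Ω → ℝ}, MemLp X 2 μ →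
      Integrable (fun ω => Complex.exp ((t / √n * X ω : ℝ) * I)) μ := fun hX =>
    .of_bound ((show Continuous fun x : ℝ => Complex.exp (x * I) by
      fun_prop).comp_aestronglyMeasurable (hX.1.const_mul _)) 1
      (.of_forall fun ω => (Complex.norm_exp_ofReal_mul_I _).le)
  have hA : ‖∫ ω, Complex.exp ((t / √n * block ξ f 0 n ω : ℝ) * I) ∂μ -
      ∫ ω, Complex.exp ((t / √n * M ω : ℝ) * I) ∂μ‖ ≤
      |t| * (√((N : ℝ) ^ 2 * c / n) +
        √(normSq μ (block ξ f 0 (W n)) / n - ρ n * (s / m))) := by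
    rw [← integral_sub (hexp hSL) (hexp hML)]
    calc _ ≤ ∫ ω, |t| / √n * |block ξ f 0 n ω - M ω| ∂μ := by
          refine norm_integral_le_of_norm_le
            (((hSL.sub hML).integrable (by norm_num)).abs.const_mul _) (.of_forall fun ω => ?_)
          refine (norm_exp_mul_I_sub_exp_mul_I_le _ _).trans (le_of_eq ?_)
          rw [← mul_sub, abs_mul, abs_div, abs_of_pos hsq0]
      _ ≤ |t| / √n * (√(normSq μ (block ξ f (W n) n)) +
            √(normSq μ (block ξ f 0 (W n) - M))) := by
          rw [integral_const_mul]
          gcongr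
      _ = |t| * (√(normSq μ (block ξ f (W n) n) / n) +
            √(normSq μ (block ξ f 0 (W n) - M) / n)) := by
          rw [Real.sqrt_div' _ hn0.le, Real.sqrt_div' _ hn0.le]
          ring
      _ ≤ _ := by
          rw [hR]
          gcongr
  have hτ : (t / √(n : ℝ)) ^ 2 = t ^ 2 / n := by rw [div_pow, Real.sq_sqrt hn0.le]
  have hB : ‖∫ ω, Complex.exp ((t / √n * M ω : ℝ) * I) ∂μ -
      Real.exp (-(t ^ 2 / 2 * (s / m) * ρ n))‖ ≤
      t ^ 2 * ε / 2 + n * β n + (t ^ 2 * (L * s) / 2) ^ 2 / n := by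
    have h1 := hmart n u
    have e1 : (u : ℝ) * ((t / √n) ^ 2 * (L * s) / 2) = t ^ 2 / 2 * (s / m) * ρ n := by
      rw [hτ, hρn, ← huL]
      field_simp
    rw [e1] at h1
    simp only [hM, Finset.sum_apply]
    refine h1.trans ?_
    rw [hτ, mul_add, mul_add]
    refine add_le_add_three ?_ ?_ ?_
    · calc (u : ℝ) * (t ^ 2 / n / 2 * (ε * L)) = (u * L) * (t ^ 2 * ε / 2) / n := by ring
        _ ≤ n * (t ^ 2 * ε / 2) / n := by gcongr
        _ = t ^ 2 * ε / 2 := by field_simp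
    · have := hβ0 n
      gcongr
    · calc (u : ℝ) * (t ^ 2 / n * (L * s) / 2) ^ 2 ≤ n * (t ^ 2 / n * (L * s) / 2) ^ 2 := by
            gcongr
        _ = (t ^ 2 * (L * s) / 2) ^ 2 / n := by field_simp
  have hC : ‖(Real.exp (-(t ^ 2 / 2 * (s / m) * ρ n)) : ℂ) - Real.exp (-(t ^ 2 / 2 * v))‖ =
      |Real.exp (-(t ^ 2 / 2 * (s / m) * ρ n)) - Real.exp (-(t ^ 2 / 2 * v))| := by
    rw [← Complex.ofReal_sub, Complex.norm_real, Real.norm_eq_abs]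
  calc _ ≤ ‖∫ ω, Complex.exp ((t / √n * block ξ f 0 n ω : ℝ) * I) ∂μ -
          ∫ ω, Complex.exp ((t / √n * M ω : ℝ) * I) ∂μ‖ +
        ‖∫ ω, Complex.exp ((t / √n * M ω : ℝ) * I) ∂μ -
          Real.exp (-(t ^ 2 / 2 * (s / m) * ρ n))‖ +
        ‖(Real.exp (-(t ^ 2 / 2 * (s / m) * ρ n)) : ℂ) - Real.exp (-(t ^ 2 / 2 * v))‖ := by
        refine le_trans (le_of_eq ?_) norm_add₃_le
        congr 1
        ring
    _ ≤ G n := add_le_add_three hA hB hC.le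

/-- If the variance of the partial sums and that of their deviations from the conditional
expectations given the endpoints have the same growth rate, the characteristic functions of the
normalized sums converge to a Gaussian one. -/
lemma tendsto_integral_exp_block (herg : IsTotallyErgodic μ ξ) {v : ℝ}
    (hv : Tendsto (fun n : ℕ => normSq μ (block ξ f 0 n) / n) atTop (𝓝 v))
    (hv' : Tendsto (fun n : ℕ => normSq μ (blockDev μ ξ f 0 n) / n) atTop (𝓝 v)) (t : ℝ) :
    Tendsto (fun n : ℕ => ∫ ω, Complex.exp ((t / √n * block ξ f 0 n ω : ℝ) * I) ∂μ) atTop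
      (𝓝 (Real.exp (-(t ^ 2 / 2 * v)))) := by
  rw [tendsto_iff_norm_sub_tendsto_zero]
  refine tendsto_order.2 ⟨fun a ha => .of_forall fun n => ha.trans_le (norm_nonneg _),
    fun a ha => ?_⟩
  have hlim : Tendsto (fun m : ℕ => |t| * √(v - normSq μ (blockDev μ ξ f 0 m) / m) +
      t ^ 2 * (1 / (m : ℝ)) / 2 + |Real.exp (-(t ^ 2 / 2 * (normSq μ (blockDev μ ξ f 0 m) / m))) -
          Real.exp (-(t ^ 2 / 2 * v))|) atTop (𝓝 0) := by
    have h1 := ((tendsto_const_nhds (x := v)).sub hv').sqrt.const_mul |t|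
    have h2 := (tendsto_one_div_atTop_nhds_zero_nat (𝕜 := ℝ)).const_mul (t ^ 2) |>.div_const 2
    have h3 := (((Real.continuous_exp.tendsto _).comp
      (hv'.const_mul (t ^ 2 / 2)).neg).sub_const (Real.exp (-(t ^ 2 / 2 * v)))).abs
    simpa using (h1.add h2).add h3
  -- The ergodic error is tied to the block length by ε = 1/m. The bound for this `m` is below a/2,
  -- and δ = a/4 leaves room to spare.
  obtain ⟨m, hm, hm1⟩ := ((hlim.eventually (gt_mem_nhds (half_pos ha))).and
    (eventually_ge_atTop 1)).exists
  have hm0 : (0 : ℝ) < m := by exact_mod_cast hm1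
  filter_upwards [hξ.eventually_norm_integral_exp_block_sub_le hf hf2 herg hv hm1
    (one_div_pos.2 hm0) (half_pos (half_pos ha)) t] with n hn
  linarith

/-- The variances of the deviations of the partial sums grow linearly. -/
lemma exists_tendsto_normSq_blockDev_div
    (hvar : ∃ C : ℝ, ∀ n : ℕ, 1 ≤ n → normSq μ (block ξ f 0 n) / n ≤ C) :
    ∃ v : NNReal, Tendsto (fun n : ℕ => normSq μ (blockDev μ ξ f 0 n) / n) atTop (𝓝 (v : ℝ)) := by
  have hsub : Subadditive fun n : ℕ => -normSq μ (blockDev μ ξ f 0 n) := fun k l => by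
    have h1 := hξ.normSq_blockDev_add_le hf hf2 (a := 0) (b := (k : ℤ)) (c := ((k + l : ℕ) : ℤ))
      (by positivity) (by push_cast; omega)
    rw [hξ.normSq_blockDev hf hf2 k l] at h1
    linarith
  obtain ⟨C, hC⟩ := hvar
  -- The maximum with 0 covers n = 0, where the quotient is 0 by convention.
  have hbdd : BddBelow (Set.range fun n : ℕ => -normSq μ (blockDev μ ξ f 0 n) / n) := by
    refine ⟨-max C 0, ?_⟩
    rintro _ ⟨n, rfl⟩
    rcases Nat.eq_zero_or_pos n with rfl | hn
    · simp
    · simp only [neg_div, neg_le_neg_iff]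
      refine le_trans ?_ ((hC n hn).trans (le_max_left _ _))
      gcongr
      have := hξ.normSq_block hf hf2 (a := 0) (b := (n : ℤ)) (by positivity)
      linarith [normSq_nonneg (μ := μ) (blockMean μ ξ f 0 n)]
  have hlim := (hsub.tendsto_lim hbdd).neg
  simp only [neg_div, neg_neg] at hlim
  have h0 : 0 ≤ -hsub.lim := ge_of_tendsto' hlim fun n =>
    div_nonneg (normSq_nonneg _) (Nat.cast_nonneg n)
  exact ⟨⟨_, h0⟩, hlim⟩

end IsStationaryMarkovChain

end CLT

end MarkovCLT

end

theorem corollary4 {Ω S : Type*} [MeasurableSpace Ω] [MeasurableSpace S]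
    (μ : Measure Ω) [IsProbabilityMeasure μ] (ξ : ℤ → Ω → S)
    (hξ : MarkovCLT.IsStationaryMarkovChain μ ξ)
    (herg : MarkovCLT.IsTotallyErgodic μ ξ)
    (f : S → ℝ) (hf : Measurable f)
    (hf2 : MemLp f 2 (μ.map (ξ 0))) (hf0 : ∫ x, f x ∂(μ.map (ξ 0)) = 0)
    (hvar : ∃ C : ℝ, ∀ n : ℕ, 1 ≤ n →
      MarkovCLT.normSq μ (MarkovCLT.partialSum ξ f n) / n ≤ C)
    (hbad : Tendsto (fun n : ℕ => (1 / (n : ℝ)) *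
      MarkovCLT.normSq μ (MarkovCLT.condEndpoints μ ξ f n)) atTop (𝓝 0)) :
    ∃ σsq : NNReal,
      Tendsto (fun n : ℕ => (1 / (n : ℝ)) *
        MarkovCLT.normSq μ (MarkovCLT.partialSum ξ f n - MarkovCLT.condEndpoints μ ξ f n))
        atTop (𝓝 (σsq : ℝ)) ∧
      Tendsto (fun n : ℕ => MarkovCLT.normSq μ (MarkovCLT.partialSum ξ f n) / n)
        atTop (𝓝 (σsq : ℝ)) ∧
      TendstoInDistribution
        (fun (n : ℕ) ω => MarkovCLT.partialSum ξ f n ω / Real.sqrt n) atTop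
        (id : ℝ → ℝ) (fun _ => μ) (gaussianReal 0 σsq) := by
  simp only [MarkovCLT.partialSum_eq_block, MarkovCLT.condEndpoints_eq_blockMean] at hvar hbad ⊢
  obtain ⟨v, hv'⟩ := hξ.exists_tendsto_normSq_blockDev_div hf hf2 hvar
  -- Pythagoras: the conditional mean contributes o(n), so the sums and their deviations have the
  -- same variance rate.
  have hv : Tendsto (fun n : ℕ => MarkovCLT.normSq μ (MarkovCLT.block ξ f 0 n) / n) atTop
      (𝓝 (v : ℝ)) := by
    have h := hbad.add hv'
    rw [zero_add] at h
    refine h.congr fun n => ?_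
    rw [hξ.normSq_block hf hf2 (a := 0) (b := (n : ℤ)) (by positivity)]
    ring
  have hmeas : ∀ n : ℕ, AEMeasurable (fun ω => MarkovCLT.block ξ f 0 n ω / Real.sqrt n) μ :=
    fun n => (hξ.memLp_block hf2 0 n).1.aemeasurable.div_const _
  refine ⟨v, ?_, hv, hmeas, aemeasurable_id, ?_⟩
  · refine hv'.congr fun n => ?_
    rw [one_div, div_eq_inv_mul, MarkovCLT.blockDev]
  · refine ProbabilityMeasure.tendsto_iff_tendsto_charFun.2 fun t => ?_
    have h := hξ.tendsto_integral_exp_block hf hf2 herg hv hv' t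
    simp only [ProbabilityMeasure.coe_mk, Measure.map_id, charFun_gaussianReal]
    convert! h using 2 with n
    · rw [charFun_apply_real, integral_map (hmeas n) (by fun_prop)]
      refine integral_congr_ae (.of_forall fun ω => ?_)
      push_cast
      ring_nf
    · push_cast
      congr 1
      ring
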